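/- Let $p$ be a prime, $\mathbb F$ a finite field of characteristic $p$, and $\phi$ the endomorphism $\sum a_iu^i\mapsto\sum a_iu^{pi}$ of $\mathbb F((u))$ (and of $\mathbb F'((u))$ for every extension $\mathbb F'$ of $\mathbb F$). Let $M$ be a two-dimensional $\mathbb F((u))$-vector space with a $\phi$-linear map $\Phi:M\to M$ whose linearization $\phi^*M\to M$ is an isomorphism, and put $M_{\mathbb F'}=\mathbb F'((u))\otimes_{\mathbb F((u))}M$ with the induced $\Phi$. Assume that $(M,\Phi)$ is absolutely simple: for every finite extension $\mathbb F'/\mathbb F$, $M_{\mathbb F'}$ has no $\Phi$-stable subspace besides $0$ and $M_{\mathbb F'}$. Let $s$ be an integer with $0\le s<p^2-1$ and $(p+1)\nmid s$ such that over some finite extension $\mathbb F'$ of $\mathbb F$ there are a basis $e_1,e_2$ of $M_{\mathbb F'}$ and $a\in\mathbb F'^{\times}$ with $\Phi(e_1)=e_2$ and $\Phi(e_2)=au^se_1$. Let $(v_\psi)_{\psi\in\Psi}$ be a finite family of integers in $\{0,1,2\}$ (for a totally ramified extension $K/\mathbb Q_p$, the index set $\Psi$ is the set of embeddings of $K$ into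 an algebraic closure of $\mathbb Q_p$), and put $e=\#\Psi$, $d'=\sum_\psi v_\psi$, $r_i=\#\{\psi\mid v_\psi\ge i\}$ for $i=1,2$. For a finite extension $\mathbb F'$ of $\mathbb F$ let $\mathcal{GR}^{\mathbf v,\mathrm{loc}}(\mathbb F')$ be the set of $\mathbb F'[[u]]$-lattices $\mathfrak M\subset M_{\mathbb F'}$ such that $u^e\mathfrak M\subset\langle\Phi(\mathfrak M)\rangle\subset\mathfrak M$, where $\langle\Phi(\mathfrak M)\rangle$ is the $\mathbb F'[[u]]$-span of $\Phi(\mathfrak M)$, and such that the Jordan type $(a_1,a_2)$, $a_1\ge a_2$, of multiplication by $u$ on $\langle\Phi(\mathfrak M)\rangle/u^e\mathfrak M$ satisfies $a_1\le r_1$ and $a_1+a_2=r_1+r_2$. Let $\mathcal{GR}^{\mathbf v,\mathrm{loc}}$ be any reduced $\mathbb F$-scheme, locally of finite type, whose $\mathbb F'$-valued points, for finite extensions $\mathbb F'$ of $\mathbb F$, are these sets, compatibly with base change (such as the closed Kisin variety, the closed reduced subscheme of the affine Grassmannian of $M$ with these points). Denote by $\xi=\frac{s}{p+1}-\left\lfloor\frac{s}{p+1}\right\rfloor$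 the fractional part of $\frac s{p+1}$. Then $\mathcal{GR}^{\mathbf v,\mathrm{loc}}$ is a single point if and only if $m=\frac{2e-d'-s}{p-1}$ is an integer and \[ \begin{cases} \ \xi\le\frac{r_1-r_2}{p+1}<2-\xi & \text{if }\left\lfloor\frac s{p+1}\right\rfloor\equiv m\bmod 2,\\[2pt] \ 1-\xi\le\frac{r_1-r_2}{p+1}<1+\xi & \text{if }\left\lfloor\frac s{p+1}\right\rfloor\not\equiv m\bmod 2. \end{cases} \] Here "single point" may be read in any of these ways, all equivalent to the condition above: $\mathcal{GR}^{\mathbf v,\mathrm{loc}}(\mathbb F')$ has exactly one element for every finite extension $\mathbb F'$ of $\mathbb F$; the structure morphism $\mathcal{GR}^{\mathbf v,\mathrm{loc}}\to\operatorname{Spec}\mathbb F$ is an isomorphism; the underlying topological space of $\mathcal{GR}^{\mathbf v,\mathrm{loc}}$ has exactly one point. -/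

import Mathlib

universe u w

open CategoryTheory AlgebraicGeometry
open scoped LaurentSeries PowerSeries TensorProduct Pointwise

noncomputable section

namespace KisinVariety

/-! ### Laurent series -/

/-- The endomorphism `φ` of `L((u))`, `∑ aᵢ uⁱ ↦ ∑ aᵢ u^{p i}`: it is the identity on coefficients
and sends `u` to `u ^ p`. -/
def phi (p : ℕ) [hp : Fact p.Prime] (L : Type*) [Field L] : L⸨X⸩ →+* L⸨X⸩ :=
  HahnSeries.embDomainRingHom (AddMonoidHom.mulLeft (p : ℤ))
    (fun a b h => by
      simpa [hp.out.ne_zero] using h)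
    (fun a b => by
      have h0 : (0 : ℤ) < p := by exact_mod_cast hp.out.pos
      simpa using mul_le_mul_iff_right₀ h0)

theorem phi_coeff_mul (p : ℕ) [hp : Fact p.Prime] (L : Type*) [Field L] (x : L⸨X⸩) (n : ℤ) :
    (phi p L x).coeff (p * n) = x.coeff n :=
  HahnSeries.embDomain_coeff (f := ⟨⟨AddMonoidHom.mulLeft (p : ℤ), _⟩, _⟩) (a := n)

theorem phi_coeff_of_not_dvd (p : ℕ) [hp : Fact p.Prime] (L : Type*) [Field L] (x : L⸨X⸩) (n : ℤ)
    (hn : ¬ (p : ℤ) ∣ n) : (phi p L x).coeff n = 0 :=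
  HahnSeries.embDomain_of_notMem_range (by
    rintro ⟨k, rfl⟩
    exact hn (Dvd.intro k rfl))

/-- The map `F((u)) → L((u))` applying `f : F → L` to all coefficients. -/
def coeffMap {F L : Type*} [Field F] [Field L] (f : F →+* L) : F⸨X⸩ →+* L⸨X⸩ where
  toFun x := HahnSeries.map x f
  map_one' := HahnSeries.map_one f.toMonoidWithZeroHom
  map_mul' _ _ := HahnSeries.map_mul (f : F →ₙ+* L)
  map_zero' := HahnSeries.map_zero (f : ZeroHom F L)
  map_add' x y := by ext; simp

theorem coeffMap_coeff {F L : Type*} [Field F] [Field L] (f : F →+* L) (x : F⸨X⸩) (n : ℤ) :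
    (coeffMap f x).coeff n = f (x.coeff n) := rfl

theorem phi_coeffMap (p : ℕ) [Fact p.Prime] {F L : Type*} [Field F] [Field L] (f : F →+* L)
    (x : F⸨X⸩) : phi p L (coeffMap f x) = coeffMap f (phi p F x) := by
  ext n
  by_cases hn : (p : ℤ) ∣ n
  · obtain ⟨k, rfl⟩ := hn
    rw [phi_coeff_mul, coeffMap_coeff, coeffMap_coeff, phi_coeff_mul]
  · rw [phi_coeff_of_not_dvd _ _ _ _ hn]
    rw [coeffMap_coeff, phi_coeff_of_not_dvd _ _ _ _ hn, map_zero]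

/-! ### `φ`-modules and their base change -/

section BaseChange

variable (F : Type*) [Field F] (L : Type*) [Field L] [Algebra F L]

/-- The algebra structure of `L((u))` over `F((u))`, through the coefficients. -/
abbrev coeffAlgebra : Algebra F⸨X⸩ L⸨X⸩ := (coeffMap (algebraMap F L)).toAlgebra

variable (M : Type*) [AddCommGroup M] [Module F⸨X⸩ M]

/-- `M_L = L((u)) ⊗_{F((u))} M`, the base change of an `F((u))`-vector space `M`. -/
def BaseChange : Type _ :=
  letI := coeffAlgebra F L
  L⸨X⸩ ⊗[F⸨X⸩] M

instance : AddCommGroup (BaseChange F L M) :=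
  letI := coeffAlgebra F L
  (TensorProduct.addCommGroup : AddCommGroup (L⸨X⸩ ⊗[F⸨X⸩] M))

instance : Module L⸨X⸩ (BaseChange F L M) :=
  letI := coeffAlgebra F L
  (TensorProduct.leftModule : Module L⸨X⸩ (L⸨X⸩ ⊗[F⸨X⸩] M))

/-- `L[[u]]` acts on `M_L` through its inclusion in `L((u))`. -/
instance : Module L⟦X⟧ (BaseChange F L M) :=
  Module.compHom (BaseChange F L M) (algebraMap L⟦X⟧ L⸨X⸩)

instance : IsScalarTower L⟦X⟧ L⸨X⸩ (BaseChange F L M) where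
  smul_assoc x y z := by
    change (x • y) • z = (algebraMap L⟦X⟧ L⸨X⸩ x) • (y • z)
    rw [Algebra.smul_def, mul_smul]

variable {F L M}

/-- The pure tensor `x ⊗ m` of `M_L`. -/
def tmul (x : L⸨X⸩) (m : M) : BaseChange F L M :=
  letI := coeffAlgebra F L
  (x ⊗ₜ[F⸨X⸩] m : L⸨X⸩ ⊗[F⸨X⸩] M)

theorem smul_tmul (y x : L⸨X⸩) (m : M) :
    y • (tmul x m : BaseChange F L M) = tmul (y * x) m := rfl

@[elab_as_elim]
theorem BaseChange.induction_on {P : BaseChange F L M → Prop} (z : BaseChange F L M)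
    (zero : P 0) (tmul : ∀ x m, P (tmul x m)) (add : ∀ x y, P x → P y → P (x + y)) : P z :=
  letI := coeffAlgebra F L
  TensorProduct.induction_on (motive := P) z zero tmul add

/-- The `φ`-linear extension `φ ⊗ Φ : M_L → M_L` of a `φ`-linear map `Φ : M → M`. -/
def Phi {p : ℕ} [Fact p.Prime] (Φ : M →ₛₗ[phi p F] M) (L : Type*) [Field L] [Algebra F L] :
    BaseChange F L M →ₛₗ[phi p L] BaseChange F L M :=
  letI := coeffAlgebra F L
  letI φL : L⸨X⸩ →ₛₗ[phi p F] L⸨X⸩ :=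
    { toFun := phi p L
      map_add' := map_add _
      map_smul' := fun c x => by
        rw [Algebra.smul_def, Algebra.smul_def, map_mul]
        congr 1
        exact phi_coeffMap p (algebraMap F L) c }
  { toFun := TensorProduct.map φL Φ
    map_add' := map_add _
    map_smul' := fun c z => by
      refine BaseChange.induction_on z ?_ ?_ ?_
      · rw [smul_zero]
        exact ((TensorProduct.map φL Φ).map_zero).trans
          ((congrArg _ (TensorProduct.map φL Φ).map_zero).trans (smul_zero _)).symm
      · intro x m
        change (phi p L (c * x) ⊗ₜ[F⸨X⸩] Φ m : L⸨X⸩ ⊗[F⸨X⸩] M)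
          = (phi p L c * phi p L x) ⊗ₜ[F⸨X⸩] Φ m
        rw [map_mul]
      · intro x y hx hy
        rw [smul_add]
        exact ((TensorProduct.map φL Φ).map_add _ _).trans ((congrArg₂ (· + ·) hx hy).trans
          ((smul_add _ _ _).symm.trans
            (congrArg _ ((TensorProduct.map φL Φ).map_add _ _).symm))) }

theorem Phi_tmul {p : ℕ} [Fact p.Prime] (Φ : M →ₛₗ[phi p F] M) (x : L⸨X⸩) (m : M) :
    Phi Φ L (tmul x m) = tmul (phi p L x) (Φ m) := rfl

/-- The map `M_L → M_{L'}` induced by an `F`-embedding `L → L'`. -/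
def transition (M : Type*) [AddCommGroup M] [Module F⸨X⸩ M] {L' : Type*} [Field L'] [Algebra F L']
    (f : L →ₐ[F] L') : BaseChange F L M →+ BaseChange F L' M :=
  letI := coeffAlgebra F L
  letI := coeffAlgebra F L'
  letI g : L⸨X⸩ →ₗ[F⸨X⸩] L'⸨X⸩ :=
    { toFun := coeffMap (f : L →+* L')
      map_add' := map_add _
      map_smul' := fun c x => by
        rw [RingHom.id_apply, Algebra.smul_def, Algebra.smul_def, map_mul]
        congr 1
        ext n
        exact f.commutes (c.coeff n) }
  (LinearMap.rTensor M g).toAddMonoidHom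

theorem transition_tmul {L' : Type*} [Field L'] [Algebra F L'] (f : L →ₐ[F] L') (x : L⸨X⸩) (m : M) :
    transition M f (tmul x m) = tmul (coeffMap (f : L →+* L') x) m := rfl

end BaseChange

section PhiModule

variable {p : ℕ} [Fact p.Prime] {F : Type u} [Field F] {M : Type w} [AddCommGroup M]
  [Module F⸨X⸩ M] (Φ : M →ₛₗ[phi p F] M)

/-- `(M, Φ)` is a two-dimensional `φ`-module over `F((u))` whose linearization `φ^*M → M` is an
isomorphism. As `φ^*M` and `M` have the same finite dimension, the latter says that the
linearization is surjective, i.e. that the image of `Φ` spans `M`. -/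
structure IsRankTwoPhiModule : Prop where
  finrank_eq : Module.finrank F⸨X⸩ M = 2
  span_range : Submodule.span F⸨X⸩ (Set.range Φ) = ⊤

/-- `(M, Φ)` is absolutely simple: for every finite extension `F'` of `F` the `φ`-module `M_{F'}`
has no `Φ`-stable subspace besides `0` and `M_{F'}`. -/
def IsAbsolutelySimple : Prop :=
  ∀ (F' : Type u) [Field F'] [Algebra F F'] [FiniteDimensional F F']
    (N : Submodule F'⸨X⸩ (BaseChange F F' M)), (∀ x ∈ N, Phi Φ F' x ∈ N) → N = ⊥ ∨ N = ⊤

/-- Over some finite extension `F'` of `F` the `φ`-module `M_{F'}` has a basis `e₁, e₂` with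
`Φ e₁ = e₂` and `Φ e₂ = a u^s e₁`, where `a ∈ F'ˣ`, `0 ≤ s < p² - 1` and `p + 1` does not
divide `s`. -/
def HasNormalForm (s : ℤ) : Prop :=
  0 ≤ s ∧ s < (p : ℤ) ^ 2 - 1 ∧ ¬ ((p : ℤ) + 1 ∣ s) ∧
  ∃ (F' : Type u) (_ : Field F') (_ : Algebra F F') (_ : FiniteDimensional F F')
    (e : Module.Basis (Fin 2) F'⸨X⸩ (BaseChange F F' M)) (a : F'), a ≠ 0 ∧
    Phi Φ F' (e 0) = e 1 ∧ Phi Φ F' (e 1) = (HahnSeries.single s a : F'⸨X⸩) • e 0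

/-! ### Lattices and the closed Kisin variety -/

/-- `⟨Φ(𝔐)⟩`, the `L[[u]]`-submodule of `M_L` generated by `Φ(𝔐)`. -/
def spanPhi {L : Type*} [Field L] [Algebra F L] (𝔐 : Submodule L⟦X⟧ (BaseChange F L M)) :
    Submodule L⟦X⟧ (BaseChange F L M) :=
  Submodule.span L⟦X⟧ (Phi Φ L '' (𝔐 : Set (BaseChange F L M)))

/-- The Jordan type of the endomorphism `u` of the `L[[u]]`-module `N` is `(a, b)`, `a ≥ b`: one
nilpotent Jordan block of size `a` and one of size `b` (a block of size `0` being absent). -/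
def HasJordanType (L : Type*) [Field L] (N : Type*) [AddCommGroup N] [Module L⟦X⟧ N]
    (a b : ℕ) : Prop :=
  b ≤ a ∧ Nonempty (N ≃ₗ[L⟦X⟧]
    ((L⟦X⟧ ⧸ Ideal.span {(PowerSeries.X : L⟦X⟧) ^ a}) ×
      (L⟦X⟧ ⧸ Ideal.span {(PowerSeries.X : L⟦X⟧) ^ b})))

variable {Ψ : Type*} [Fintype Ψ] (v : Ψ → ℕ)

/-- `r_i = #{ψ | v_ψ ≥ i}`. -/
def dualPart (i : ℕ) : ℕ := {ψ : Ψ | i ≤ v ψ}.ncard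

/-- `GR^{v,loc}(L)`, with `e = #Ψ`: the `L[[u]]`-lattices `𝔐` in `M_L` with
`u^e 𝔐 ⊆ ⟨Φ(𝔐)⟩ ⊆ 𝔐` such that the Jordan type of `u` on `⟨Φ(𝔐)⟩ / u^e 𝔐` is `≤ (r₁, r₂)`. -/
def GRloc (L : Type*) [Field L] [Algebra F L] : Set (Submodule L⟦X⟧ (BaseChange F L M)) :=
  {𝔐 | Submodule.IsLattice L⸨X⸩ 𝔐 ∧
    (PowerSeries.X : L⟦X⟧) ^ Fintype.card Ψ • 𝔐 ≤ spanPhi Φ 𝔐 ∧ spanPhi Φ 𝔐 ≤ 𝔐 ∧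
    ∃ a b : ℕ,
      HasJordanType L
        (↥(spanPhi Φ 𝔐) ⧸
          ((PowerSeries.X : L⟦X⟧) ^ Fintype.card Ψ • 𝔐).submoduleOf (spanPhi Φ 𝔐)) a b ∧
      a ≤ dualPart v 1 ∧ a + b = dualPart v 1 + dualPart v 2}

/-- The base change of a lattice along an `F`-embedding `L → L'`: the `L'[[u]]`-span of its image
in `M_{L'}`. -/
def latticeBaseChange {L L' : Type*} [Field L] [Algebra F L] [Field L'] [Algebra F L']
    (f : L →ₐ[F] L') (𝔐 : Submodule L⟦X⟧ (BaseChange F L M)) :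
    Submodule L'⟦X⟧ (BaseChange F L' M) :=
  Submodule.span L'⟦X⟧ (transition M f '' (𝔐 : Set (BaseChange F L M)))

/-- The `F'`-valued points of an `F`-scheme `π : Z → Spec F`. -/
abbrev Points {Z : Scheme.{u}} (π : Z ⟶ Spec (CommRingCat.of F)) (F' : Type u) [Field F']
    [Algebra F F'] : Type u :=
  {g : Spec (CommRingCat.of F') ⟶ Z // g ≫ π = Spec.map (CommRingCat.ofHom (algebraMap F F'))}

/-- The `F`-scheme `π : Z → Spec F` is the closed Kisin variety `GR^{v,loc}`: it is reduced and
of finite type locally over `F`, and for finite extensions `F'` of `F` its `F'`-valued points are,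
compatibly with base change, the elements of `GR^{v,loc}(F')`. -/
structure ClosedKisinVariety {Z : Scheme.{u}} (π : Z ⟶ Spec (CommRingCat.of F)) where
  isReduced : IsReduced Z
  locallyOfFiniteType : LocallyOfFiniteType π
  pointsEquiv : ∀ (F' : Type u) [Field F'] [Algebra F F'] [FiniteDimensional F F'],
    Points π F' ≃ GRloc Φ v F'
  naturality : ∀ (F' F'' : Type u) [Field F'] [Algebra F F'] [FiniteDimensional F F']
    [Field F''] [Algebra F F''] [FiniteDimensional F F''] (f : F' →ₐ[F] F'')
    (g : Points π F') (g' : Points π F''),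
    g'.1 = Spec.map (CommRingCat.ofHom (f : F' →+* F'')) ≫ g.1 →
    (pointsEquiv F'' g' : Submodule F''⟦X⟧ (BaseChange F F'' M)) =
      latticeBaseChange f (pointsEquiv F' g : Submodule F'⟦X⟧ (BaseChange F F' M))

/-- The numerical condition, with `e = #Ψ`, `d' = ∑ v_ψ` and `ξ` the fractional part of
`s / (p + 1)`: the number `m = (2e - d' - s) / (p - 1)` is an integer, and `(r₁ - r₂) / (p + 1)`
lies in `[ξ, 2 - ξ)` if `⌊s / (p + 1)⌋ ≡ m mod 2`, and in `[1 - ξ, 1 + ξ)` otherwise. -/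
def SinglePointCondition (p : ℕ) (s : ℤ) : Prop :=
  ∃ m : ℤ, ((p : ℤ) - 1) * m = 2 * (Fintype.card Ψ : ℤ) - ∑ ψ, (v ψ : ℤ) - s ∧
    (⌊(s : ℚ) / (p + 1)⌋ ≡ m [ZMOD 2] →
      Int.fract ((s : ℚ) / (p + 1)) ≤ ((dualPart v 1 : ℚ) - dualPart v 2) / (p + 1) ∧
      ((dualPart v 1 : ℚ) - dualPart v 2) / (p + 1) < 2 - Int.fract ((s : ℚ) / (p + 1))) ∧
    (¬ ⌊(s : ℚ) / (p + 1)⌋ ≡ m [ZMOD 2] →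
      1 - Int.fract ((s : ℚ) / (p + 1)) ≤ ((dualPart v 1 : ℚ) - dualPart v 2) / (p + 1) ∧
      ((dualPart v 1 : ℚ) - dualPart v 2) / (p + 1) < 1 + Int.fract ((s : ℚ) / (p + 1)))

end PhiModule

end KisinVariety

end

noncomputable section

namespace KisinVariety

/-! ### Orders of Laurent series -/

section Order

variable {L : Type*} [Field L]

/-! The normal form already exists over the ground field (`HasNormalForm.exists_isNormalForm`), so
every extension carries a basis `e₀, e₁` with `Φ e₀ = e₁`, `Φ e₁ = a u ^ s e₀`, and the count of
lattices is the same purely numerical problem over each of them.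

Comparing determinants of `⟨Φ 𝔐⟩` and `u ^ e 𝔐`, the equation `a₁ + a₂ = r₁ + r₂` says that the
index `m` of `𝔐` satisfies `(p - 1) m = 2e - d' - s`. The bound `a₁ ≤ r₁` says that `Φ 𝔐 ⊆ u ^ A 𝔐`
with `A = e - r₁`. A rank two lattice is its own dual, up to a twist, under the wedge pairing
(`HasIndex.mem_iff`), so this inclusion means that `x ∧ Φ y` has order at least `A + m` for all `x,
y` in `𝔐`. On the diagonal, `x ∧ Φ x` is a difference of two terms whose orders are incongruent
modulo `p + 1`, since `p + 1 ∤ s`. They cannot cancel, and each coordinate of `x` is bounded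
separately. Conversely those coordinate bounds suffice. Hence the points are exactly the sublattices
of index `m` of one lattice `⟨u ^ α e₀, u ^ β e₁⟩`, where `α`, `β` are the ceilings of `(A + m) / (p
+ 1)` and `(A + m - s) / (p + 1)`. There is just one if and only if `α + β = m`, and a parity
discussion turns this into the stated inequalities.

The scheme versions follow because closed points are visible over finite extensions, and because
nonemptiness of the set of lattices does not depend on the field, which supplies a rational point.
-/

theorem exists_coe_eq_of_orderTop_nonneg {x : L⸨X⸩} (hx : 0 ≤ x.orderTop) :
    ∃ f : L⟦X⟧, algebraMap L⟦X⟧ L⸨X⸩ f = x := by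
  refine ⟨PowerSeries.mk fun n => x.coeff n, ?_⟩
  ext n
  rw [LaurentSeries.coe_algebraMap, PowerSeries.coeff_coe]
  split_ifs with hn
  · exact (HahnSeries.coeff_eq_zero_of_lt_orderTop (lt_of_lt_of_le (by exact_mod_cast hn) hx)).symm
  · rw [PowerSeries.coeff_mk, Int.natAbs_of_nonneg (by omega)]

theorem orderTop_algebraMap_nonneg (f : L⟦X⟧) : 0 ≤ (algebraMap L⟦X⟧ L⸨X⸩ f).orderTop := by
  rw [HahnSeries.le_orderTop_iff_forall]
  intro j hj
  rw [LaurentSeries.coe_algebraMap, PowerSeries.coeff_coe, if_pos (by exact_mod_cast hj)]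

theorem orderTop_algebraMap_X_pow (n : ℕ) :
    (algebraMap L⟦X⟧ L⸨X⸩ (PowerSeries.X ^ n)).orderTop = (n : ℤ) := by
  rw [LaurentSeries.coe_algebraMap, HahnSeries.ofPowerSeries_X_pow,
    HahnSeries.orderTop_single one_ne_zero]

theorem orderTop_algebraMap_of_isUnit {f : L⟦X⟧} (hf : IsUnit f) :
    (algebraMap L⟦X⟧ L⸨X⸩ f).orderTop = 0 := by
  obtain ⟨g, hg⟩ := hf.exists_right_inv
  have h : (algebraMap L⟦X⟧ L⸨X⸩ f).orderTop + (algebraMap L⟦X⟧ L⸨X⸩ g).orderTop = 0 := by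
    rw [← HahnSeries.orderTop_mul, ← map_mul, hg, map_one, HahnSeries.orderTop_one]
  have h1 := orderTop_algebraMap_nonneg f
  have h2 := orderTop_algebraMap_nonneg g
  exact le_antisymm (h ▸ le_add_of_nonneg_right h2) h1

theorem orderTop_mul_ge {x y : L⸨X⸩} {m n : ℤ} (hx : (m : WithTop ℤ) ≤ x.orderTop)
    (hy : (n : WithTop ℤ) ≤ y.orderTop) : ((m + n : ℤ) : WithTop ℤ) ≤ (x * y).orderTop := by
  rw [HahnSeries.orderTop_mul]
  push_cast
  exact add_le_add hx hy

theorem orderTop_sub_ge {x y : L⸨X⸩} {n : WithTop ℤ} (hx : n ≤ x.orderTop)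
    (hy : n ≤ y.orderTop) : n ≤ (x - y).orderTop :=
  (le_min hx hy).trans HahnSeries.min_orderTop_le_orderTop_sub

theorem orderTop_algebraMap_mul_ge (f : L⟦X⟧) {x : L⸨X⸩} {n : ℤ}
    (hx : (n : WithTop ℤ) ≤ x.orderTop) :
    (n : WithTop ℤ) ≤ (algebraMap L⟦X⟧ L⸨X⸩ f * x).orderTop := by
  have h := orderTop_mul_ge (m := 0) (orderTop_algebraMap_nonneg f) hx
  rwa [zero_add] at h

theorem orderTop_div_nonneg {x y : L⸨X⸩} {n : ℤ} (hx : (n : WithTop ℤ) ≤ x.orderTop)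
    (hy : y.orderTop = n) : 0 ≤ (x / y).orderTop := by
  have hy0 : y ≠ 0 := by
    rintro rfl
    simp at hy
  by_contra! h
  have h1 : x.orderTop = (x / y).orderTop + y.orderTop := by
    rw [← HahnSeries.orderTop_mul, div_mul_cancel₀ _ hy0]
  rw [h1, hy] at hx
  generalize (x / y).orderTop = t at hx h
  induction t with
  | top => simp at h
  | coe t => norm_cast at hx h; omega

variable (p : ℕ) [hp : Fact p.Prime]

theorem orderTop_phi (x : L⸨X⸩) :
    (phi p L x).orderTop = WithTop.map (fun n : ℤ => p * n) x.orderTop :=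
  HahnSeries.orderTop_embDomain (f := ⟨⟨AddMonoidHom.mulLeft (p : ℤ), _⟩, _⟩) (x := x)

theorem orderTop_phi_of_eq {x : L⸨X⸩} {n : ℤ} (hx : x.orderTop = n) :
    (phi p L x).orderTop = (p * n : ℤ) := by
  rw [orderTop_phi, hx, WithTop.map_coe]

theorem phi_single (n : ℤ) (a : L) :
    phi p L (HahnSeries.single n a) = HahnSeries.single (p * n) a :=
  HahnSeries.embDomain_single (f := ⟨⟨AddMonoidHom.mulLeft (p : ℤ), _⟩, _⟩)

theorem orderTop_phi_ge {x : L⸨X⸩} {n : ℤ} (hx : (n : WithTop ℤ) ≤ x.orderTop) :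
    ((p * n : ℤ) : WithTop ℤ) ≤ (phi p L x).orderTop := by
  rw [orderTop_phi]
  generalize x.orderTop = t at hx
  induction t with
  | top => simp
  | coe t =>
    rw [WithTop.map_coe]
    norm_cast at hx ⊢
    exact mul_le_mul_of_nonneg_left hx (by positivity)

end Order

/-! ### Lattices in a plane and their index -/

section Lattice

variable {L : Type*} [Field L] {V : Type*} [AddCommGroup V] [Module L⸨X⸩ V]
  (e : Module.Basis (Fin 2) L⸨X⸩ V)

/-- The coordinate of `x ∧ y` with respect to `e₀ ∧ e₁`. -/
def wedge (x y : V) : L⸨X⸩ := e.repr x 0 * e.repr y 1 - e.repr x 1 * e.repr y 0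

/-- Cramer's rule: when `x ∧ y ≠ 0`, the coordinates of `z` along `x, y` are quotients of wedges. -/
theorem wedge_cramer (x y z : V) : wedge e x y • z = wedge e z y • x + wedge e x z • y := by
  refine e.ext_elem fun i => ?_
  fin_cases i <;> simp [wedge] <;> ring

theorem wedge_smul_left (c : L⸨X⸩) (x y : V) : wedge e (c • x) y = c * wedge e x y := by
  simp [wedge]; ring

theorem wedge_smul_right (c : L⸨X⸩) (x y : V) : wedge e x (c • y) = c * wedge e x y := by
  simp [wedge]; ring

theorem wedge_basis : wedge e (e 0) (e 1) = 1 := by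
  simp [wedge]

theorem wedge_comb (a b c d : L⸨X⸩) (x y : V) :
    wedge e (a • x + b • y) (c • x + d • y) = (a * d - b * c) * wedge e x y := by
  simp [wedge]; ring

variable {e} in
theorem wedge_ne_zero_of_basis (b : Module.Basis (Fin 2) L⸨X⸩ V) : wedge e (b 0) (b 1) ≠ 0 := by
  intro h0
  have key : ∀ z, wedge e (b 0) z = 0 := by
    intro z
    have h := wedge_cramer e (b 0) (b 1) z
    rw [h0, zero_smul] at h
    have := congrArg (fun v => b.repr v 1) h
    simpa using this.symm
  have h1 := key (e 0)
  have h2 := key (e 1)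
  simp [wedge] at h1 h2
  refine b.ne_zero 0 (e.ext_elem fun i => ?_)
  fin_cases i <;> simp [h1, h2]

variable [Module L⟦X⟧ V]

/-- `𝔐` is a lattice whose determinant is `u ^ i` times that of the lattice spanned by `e`. -/
def HasIndex (𝔐 : Submodule L⟦X⟧ V) (i : ℤ) : Prop :=
  ∃ x y : V, 𝔐 = Submodule.span L⟦X⟧ {x, y} ∧ (wedge e x y).orderTop = i

theorem hasIndex_span_single_smul (α β : ℤ) :
    HasIndex e (Submodule.span L⟦X⟧ {(HahnSeries.single α (1 : L) : L⸨X⸩) • e 0,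
      (HahnSeries.single β (1 : L) : L⸨X⸩) • e 1}) (α + β) := by
  refine ⟨_, _, rfl, ?_⟩
  rw [wedge_smul_left, wedge_smul_right, wedge_basis, mul_one, HahnSeries.single_mul_single,
    HahnSeries.orderTop_single (by simp)]

variable {e} [IsScalarTower L⟦X⟧ L⸨X⸩ V]

theorem orderTop_wedge_ge_of_mem_span {x y z w : V} {i : ℤ} (h : (wedge e x y).orderTop = i)
    (hz : z ∈ Submodule.span L⟦X⟧ {x, y}) (hw : w ∈ Submodule.span L⟦X⟧ {x, y}) :
    (i : WithTop ℤ) ≤ (wedge e z w).orderTop := by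
  obtain ⟨a, b, rfl⟩ := Submodule.mem_span_pair.1 hz
  obtain ⟨c, d, rfl⟩ := Submodule.mem_span_pair.1 hw
  rw [← algebraMap_smul L⸨X⸩ a, ← algebraMap_smul L⸨X⸩ b, ← algebraMap_smul L⸨X⸩ c,
    ← algebraMap_smul L⸨X⸩ d, wedge_comb, ← map_mul, ← map_mul, ← map_sub]
  exact orderTop_algebraMap_mul_ge _ h.ge

theorem HasIndex.le_orderTop_wedge {𝔐 : Submodule L⟦X⟧ V} {i : ℤ} (h : HasIndex e 𝔐 i) {z w : V}
    (hz : z ∈ 𝔐) (hw : w ∈ 𝔐) : (i : WithTop ℤ) ≤ (wedge e z w).orderTop := by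
  obtain ⟨x, y, rfl, h⟩ := h
  exact orderTop_wedge_ge_of_mem_span h hz hw

/-- Self-duality of rank two lattices: by Cramer's rule, pairing `z` with the two generators to
order at least `i` makes both coordinates of `z` integral. -/
theorem HasIndex.mem_iff {𝔐 : Submodule L⟦X⟧ V} {i : ℤ} (h : HasIndex e 𝔐 i) {z : V} :
    z ∈ 𝔐 ↔ ∀ w ∈ 𝔐, (i : WithTop ℤ) ≤ (wedge e w z).orderTop := by
  refine ⟨fun hz w hw => h.le_orderTop_wedge hw hz, fun H => ?_⟩
  obtain ⟨x, y, rfl, h⟩ := h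
  have h0 : wedge e x y ≠ 0 := by
    intro h0
    simp [h0] at h
  have hx := H x (Submodule.subset_span (by simp))
  have hy : (i : WithTop ℤ) ≤ (wedge e z y).orderTop := by
    have := H y (Submodule.subset_span (by simp))
    rwa [show wedge e z y = -wedge e y z by simp only [wedge]; ring, HahnSeries.orderTop_neg]
  obtain ⟨a, ha⟩ := exists_coe_eq_of_orderTop_nonneg (orderTop_div_nonneg hx h)
  obtain ⟨b, hb⟩ := exists_coe_eq_of_orderTop_nonneg (orderTop_div_nonneg hy h)
  refine Submodule.mem_span_pair.2 ⟨b, a, ?_⟩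
  rw [← algebraMap_smul L⸨X⸩ a, ← algebraMap_smul L⸨X⸩ b, ha, hb]
  have := congrArg (fun v => (wedge e x y)⁻¹ • v) (wedge_cramer e x y z)
  simp only [smul_add, smul_smul, inv_mul_cancel₀ h0, one_smul] at this
  rw [div_eq_inv_mul, div_eq_inv_mul, ← this]

theorem HasIndex.le_of_le {𝔐 𝔑 : Submodule L⟦X⟧ V} {i j : ℤ} (hM : HasIndex e 𝔐 i)
    (hN : HasIndex e 𝔑 j) (hle : 𝔐 ≤ 𝔑) : j ≤ i := by
  obtain ⟨x, y, rfl, h⟩ := hM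
  have := hN.le_orderTop_wedge (hle (Submodule.subset_span (Set.mem_insert x {y})))
    (hle (Submodule.subset_span (Set.mem_insert_of_mem x rfl)))
  rw [h] at this
  exact_mod_cast this

theorem HasIndex.unique {𝔐 : Submodule L⟦X⟧ V} {i j : ℤ} (hi : HasIndex e 𝔐 i)
    (hj : HasIndex e 𝔐 j) : i = j :=
  le_antisymm (hj.le_of_le hi le_rfl) (hi.le_of_le hj le_rfl)

theorem HasIndex.eq_of_le {𝔐 𝔑 : Submodule L⟦X⟧ V} {i : ℤ} (hM : HasIndex e 𝔐 i)
    (hN : HasIndex e 𝔑 i) (hle : 𝔐 ≤ 𝔑) : 𝔐 = 𝔑 :=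
  le_antisymm hle fun _ hz => hM.mem_iff.2 fun _ hw => hN.le_orderTop_wedge (hle hw) hz

theorem HasIndex.isLattice {𝔐 : Submodule L⟦X⟧ V} {i : ℤ} (h : HasIndex e 𝔐 i) :
    Submodule.IsLattice L⸨X⸩ 𝔐 := by
  obtain ⟨x, y, rfl, h⟩ := h
  refine ⟨Submodule.fg_span (by simp), eq_top_iff.2 fun z _ => ?_⟩
  have h0 : wedge e x y ≠ 0 := by
    intro h0
    simp [h0] at h
  rw [Submodule.span_span_of_tower, ← Submodule.smul_mem_iff _ h0, wedge_cramer e x y z]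
  exact Submodule.mem_span_pair.2 ⟨_, _, rfl⟩

theorem hasIndex_of_basis {𝔐 : Submodule L⟦X⟧ V} [Submodule.IsLattice L⸨X⸩ 𝔐]
    (b : Module.Basis (Fin 2) L⟦X⟧ 𝔐) :
    ∃ i : ℤ, (wedge e (b 0 : V) (b 1 : V)).orderTop = i ∧ HasIndex e 𝔐 i := by
  have h0 : wedge e (b 0 : V) (b 1 : V) ≠ 0 := by
    have := wedge_ne_zero_of_basis (e := e) (b.extendOfIsLattice L⸨X⸩)
    simpa using this
  have hi := (HahnSeries.order_eq_orderTop_of_ne_zero h0).symm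
  refine ⟨_, hi, b 0, b 1, ?_, hi⟩
  have := congrArg (Submodule.map 𝔐.subtype) b.span_eq
  rw [Submodule.map_span, Submodule.map_top, Submodule.range_subtype] at this
  refine this.symm.trans (congrArg _ ?_)
  ext z
  simp [eq_comm]

theorem exists_basis_of_isLattice (hV : Module.rank L⸨X⸩ V = 2) (𝔐 : Submodule L⟦X⟧ V)
    [Submodule.IsLattice L⸨X⸩ 𝔐] :
    Nonempty (Module.Basis (Fin 2) L⟦X⟧ 𝔐) := by
  have hr : Module.finrank L⟦X⟧ 𝔐 = 2 :=
    Module.finrank_eq_of_rank_eq (by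
      rw [Submodule.IsLattice.rank' L⸨X⸩ 𝔐, hV]; simp)
  have := Submodule.IsLattice.free L⸨X⸩ 𝔐
  exact ⟨(Module.finBasisOfFinrankEq _ _ hr)⟩

variable (e) in
theorem exists_hasIndex (𝔐 : Submodule L⟦X⟧ V) [Submodule.IsLattice L⸨X⸩ 𝔐] :
    ∃ i, HasIndex e 𝔐 i := by
  obtain ⟨b⟩ := exists_basis_of_isLattice (by simpa using rank_eq_card_basis e) 𝔐
  obtain ⟨i, -, hi⟩ := hasIndex_of_basis (e := e) b
  exact ⟨i, hi⟩

theorem mem_X_pow_smul_iff (𝔐 : Submodule L⟦X⟧ V) (n : ℕ) (z : V) :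
    z ∈ (PowerSeries.X : L⟦X⟧) ^ n • 𝔐 ↔ (HahnSeries.single (-n : ℤ) (1 : L) : L⸨X⸩) • z ∈ 𝔐 := by
  have hX : algebraMap L⟦X⟧ L⸨X⸩ (PowerSeries.X ^ n) = HahnSeries.single (n : ℤ) (1 : L) := by
    rw [LaurentSeries.coe_algebraMap, HahnSeries.ofPowerSeries_X_pow]
  rw [Submodule.mem_smul_pointwise_iff_exists]
  constructor
  · rintro ⟨y, hy, rfl⟩
    rw [← algebraMap_smul L⸨X⸩ _ y, hX, smul_smul, HahnSeries.single_mul_single]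
    simpa using hy
  · intro h
    refine ⟨_, h, ?_⟩
    rw [← algebraMap_smul L⸨X⸩ (_ ^ n), hX, smul_smul, HahnSeries.single_mul_single]
    simp

theorem HasIndex.mem_X_pow_smul_iff {𝔐 : Submodule L⟦X⟧ V} {i : ℤ} (h : HasIndex e 𝔐 i) (n : ℕ)
    {z : V} : z ∈ (PowerSeries.X : L⟦X⟧) ^ n • 𝔐 ↔
      ∀ w ∈ 𝔐, ((n + i : ℤ) : WithTop ℤ) ≤ (wedge e w z).orderTop := by
  rw [KisinVariety.mem_X_pow_smul_iff, h.mem_iff]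
  refine forall₂_congr fun w _ => ?_
  rw [wedge_smul_right, HahnSeries.orderTop_mul, HahnSeries.orderTop_single one_ne_zero]
  generalize (wedge e w z).orderTop = t
  induction t with
  | top => simp
  | coe t =>
    norm_cast
    omega

theorem HasIndex.X_pow_smul {𝔐 : Submodule L⟦X⟧ V} {i : ℤ} (h : HasIndex e 𝔐 i) (n : ℕ) :
    HasIndex e ((PowerSeries.X : L⟦X⟧) ^ n • 𝔐) (2 * n + i) := by
  obtain ⟨x, y, rfl, h⟩ := h
  refine ⟨(PowerSeries.X : L⟦X⟧) ^ n • x, (PowerSeries.X : L⟦X⟧) ^ n • y, ?_, ?_⟩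
  · rw [Submodule.smul_span, Set.smul_set_insert, Set.smul_set_singleton]
  · rw [← algebraMap_smul L⸨X⸩, ← algebraMap_smul L⸨X⸩ _ y, wedge_smul_left, wedge_smul_right,
      HahnSeries.orderTop_mul, HahnSeries.orderTop_mul, orderTop_algebraMap_X_pow, h]
    norm_cast
    push_cast
    ring

theorem mem_span_single_smul_iff (α β : ℤ) (z : V) :
    z ∈ Submodule.span L⟦X⟧ {(HahnSeries.single α (1 : L) : L⸨X⸩) • e 0,
      (HahnSeries.single β (1 : L) : L⸨X⸩) • e 1} ↔
      (α : WithTop ℤ) ≤ (e.repr z 0).orderTop ∧ (β : WithTop ℤ) ≤ (e.repr z 1).orderTop := by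
  rw [Submodule.mem_span_pair]
  constructor
  · rintro ⟨a, b, rfl⟩
    rw [← algebraMap_smul L⸨X⸩ a, ← algebraMap_smul L⸨X⸩ b]
    constructor
    · have := orderTop_algebraMap_mul_ge a (x := HahnSeries.single α (1 : L)) (n := α)
        (HahnSeries.orderTop_single one_ne_zero).ge
      simpa using this
    · have := orderTop_algebraMap_mul_ge b (x := HahnSeries.single β (1 : L)) (n := β)
        (HahnSeries.orderTop_single one_ne_zero).ge
      simpa using this
  · rintro ⟨h0, h1⟩
    obtain ⟨a, ha⟩ := exists_coe_eq_of_orderTop_nonneg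
      (orderTop_div_nonneg h0 (HahnSeries.orderTop_single (one_ne_zero (α := L))))
    obtain ⟨b, hb⟩ := exists_coe_eq_of_orderTop_nonneg
      (orderTop_div_nonneg h1 (HahnSeries.orderTop_single (one_ne_zero (α := L))))
    refine ⟨a, b, ?_⟩
    rw [← algebraMap_smul L⸨X⸩ a, ← algebraMap_smul L⸨X⸩ b, ha, hb, smul_smul, smul_smul,
      div_mul_cancel₀ _ (by simp), div_mul_cancel₀ _ (by simp)]
    rw [← Fin.sum_univ_two fun i => e.repr z i • e i, e.sum_repr]

end Lattice

/-! ### Jordan types of quotients of lattices -/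

section Jordan

variable {L : Type*} [Field L]

/-- The coefficients of `u ^ k` for `k < n` identify the quotient with `L ^ n`. -/
theorem finrank_quotient_span_X_pow (n : ℕ) :
    Module.finrank L (L⟦X⟧ ⧸ Ideal.span {(PowerSeries.X : L⟦X⟧) ^ n}) = n ∧
      Module.Finite L (L⟦X⟧ ⧸ Ideal.span {(PowerSeries.X : L⟦X⟧) ^ n}) := by
  let f : L⟦X⟧ →ₗ[L] (Fin n → L) := LinearMap.pi fun i => PowerSeries.coeff (i : ℕ)
  have hf : Function.Surjective f := fun c => by
    refine ⟨PowerSeries.mk fun k => if h : k < n then c ⟨k, h⟩ else 0, ?_⟩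
    ext i
    simp [f]
  have hker : LinearMap.ker f =
      (Ideal.span {(PowerSeries.X : L⟦X⟧) ^ n}).restrictScalars L := by
    ext x
    rw [LinearMap.mem_ker, Submodule.restrictScalars_mem, Ideal.mem_span_singleton,
      PowerSeries.X_pow_dvd_iff]
    constructor
    · intro h m hm
      exact congrFun h ⟨m, hm⟩
    · intro h
      ext i
      exact h i i.2
  let E : (L⟦X⟧ ⧸ Ideal.span {(PowerSeries.X : L⟦X⟧) ^ n}) ≃ₗ[L] (Fin n → L) :=
    (Submodule.Quotient.restrictScalarsEquiv L _).symm.trans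
      ((Submodule.quotEquivOfEq _ _ hker.symm).trans (f.quotKerEquivOfSurjective hf))
  exact ⟨by simp [E.finrank_eq], Module.Finite.equiv E.symm⟩

theorem add_eq_of_linearEquiv {a b c d : ℕ}
    (E : ((L⟦X⟧ ⧸ Ideal.span {(PowerSeries.X : L⟦X⟧) ^ a}) ×
      (L⟦X⟧ ⧸ Ideal.span {(PowerSeries.X : L⟦X⟧) ^ b})) ≃ₗ[L⟦X⟧]
      ((L⟦X⟧ ⧸ Ideal.span {(PowerSeries.X : L⟦X⟧) ^ c}) ×
      (L⟦X⟧ ⧸ Ideal.span {(PowerSeries.X : L⟦X⟧) ^ d}))) : a + b = c + d := by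
  have h := (E.restrictScalars L).finrank_eq
  have (n : ℕ) := (finrank_quotient_span_X_pow (L := L) n).2
  have (n : ℕ) := Module.Free.of_divisionRing L (L⟦X⟧ ⧸ Ideal.span {(PowerSeries.X : L⟦X⟧) ^ n})
  rw [Module.finrank_prod, Module.finrank_prod] at h
  simpa only [(finrank_quotient_span_X_pow (L := L) _).1] using h

/-- Together with `HasJordanType.le_of_X_pow_smul_eq_zero`, this makes the bound on the largest
block equivalent to annihilation by a power of `u`. -/
theorem HasJordanType.X_pow_smul_eq_zero {N : Type*} [AddCommGroup N] [Module L⟦X⟧ N] {a b : ℕ}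
    (h : HasJordanType L N a b) {r : ℕ} (hr : a ≤ r) (x : N) :
    (PowerSeries.X : L⟦X⟧) ^ r • x = 0 := by
  obtain ⟨hab, ⟨E⟩⟩ := h
  have key (n : ℕ) (hn : n ≤ r) (y : L⟦X⟧ ⧸ Ideal.span {(PowerSeries.X : L⟦X⟧) ^ n}) :
      (PowerSeries.X : L⟦X⟧) ^ r • y = 0 := by
    obtain ⟨y, rfl⟩ := Ideal.Quotient.mk_surjective y
    rw [← Ideal.Quotient.mk_eq_mk, ← Submodule.Quotient.mk_smul, Submodule.Quotient.mk_eq_zero,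
      Ideal.mem_span_singleton]
    exact Dvd.dvd.mul_right (pow_dvd_pow _ hn) _
  apply E.injective
  rw [map_smul, map_zero]
  exact Prod.ext (key a hr _) (key b (hab.trans hr) _)

theorem HasJordanType.le_of_X_pow_smul_eq_zero {N : Type*} [AddCommGroup N] [Module L⟦X⟧ N]
    {a b : ℕ} (h : HasJordanType L N a b) {r : ℕ}
    (hr : ∀ x : N, (PowerSeries.X : L⟦X⟧) ^ r • x = 0) : a ≤ r := by
  obtain ⟨-, ⟨E⟩⟩ := h
  have h1 := hr (E.symm (Submodule.Quotient.mk 1, 0))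
  rw [← map_smul, E.symm.map_eq_zero_iff, Prod.smul_mk, Prod.mk_eq_zero,
    ← Submodule.Quotient.mk_smul, Submodule.Quotient.mk_eq_zero, Ideal.mem_span_singleton,
    smul_eq_mul, mul_one] at h1
  exact (pow_dvd_pow_iff PowerSeries.X_ne_zero PowerSeries.X_prime.not_isUnit).1 h1.1

theorem X_pow_smul_quotient_eq_zero_iff {V : Type*} [AddCommGroup V] [Module L⟦X⟧ V]
    {N K : Submodule L⟦X⟧ V} (r : ℕ) :
    (∀ x : ↥N ⧸ K.submoduleOf N, (PowerSeries.X : L⟦X⟧) ^ r • x = 0) ↔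
      ∀ x ∈ N, (PowerSeries.X : L⟦X⟧) ^ r • x ∈ K := by
  constructor
  · intro h x hx
    have := h (Submodule.Quotient.mk ⟨x, hx⟩)
    rw [← Submodule.Quotient.mk_smul, Submodule.Quotient.mk_eq_zero] at this
    exact this
  · intro h x
    obtain ⟨x, rfl⟩ := Submodule.Quotient.mk_surjective _ x
    rw [← Submodule.Quotient.mk_smul, Submodule.Quotient.mk_eq_zero]
    exact h x x.2

variable {V : Type*} [AddCommGroup V] [Module L⸨X⸩ V] [Module L⟦X⟧ V]
  [IsScalarTower L⟦X⟧ L⸨X⸩ V] {e : Module.Basis (Fin 2) L⸨X⸩ V}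

theorem exists_X_pow_associated {a : L⟦X⟧} (ha : a ≠ 0) :
    ∃ n : ℕ, Ideal.span {a} = Ideal.span {(PowerSeries.X : L⟦X⟧) ^ n} ∧
      (algebraMap L⟦X⟧ L⸨X⸩ a).orderTop = (n : ℤ) := by
  obtain ⟨n, c, hc⟩ := IsDiscreteValuationRing.associated_pow_irreducible ha
    (PowerSeries.X_prime (R := L)).irreducible
  have hn : a * (c : L⟦X⟧) = PowerSeries.X ^ n := hc
  refine ⟨n, Ideal.span_singleton_eq_span_singleton.2 ⟨c, hc⟩, ?_⟩
  rw [← orderTop_algebraMap_X_pow (L := L), ← hn, map_mul, HahnSeries.orderTop_mul,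
    orderTop_algebraMap_of_isUnit c.isUnit, add_zero]

/-- Elementary divisors: in adapted bases the inclusion is diagonal with entries powers of `u` up to
units. These give the Jordan blocks, and the determinant gives the change of index. -/
theorem HasIndex.exists_hasJordanType {N K : Submodule L⟦X⟧ V} {j k : ℤ} (hN : HasIndex e N j)
    (hK : HasIndex e K k) (hle : K ≤ N) :
    ∃ a b : ℕ, HasJordanType L (↥N ⧸ K.submoduleOf N) a b ∧ k = j + a + b := by
  have := hN.isLattice
  have := hK.isLattice
  have hV : Module.rank L⸨X⸩ V = 2 := by simpa using rank_eq_card_basis e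
  obtain ⟨bN⟩ := exists_basis_of_isLattice hV N
  obtain ⟨bK⟩ := exists_basis_of_isLattice hV K
  let EK : K.submoduleOf N ≃ₗ[L⟦X⟧] K := Submodule.submoduleOfEquivOfLe hle
  have hr : Module.finrank L⟦X⟧ (K.submoduleOf N) = Module.finrank L⟦X⟧ N := by
    rw [EK.finrank_eq, Module.finrank_eq_card_basis bN, Module.finrank_eq_card_basis bK]
  let b := Submodule.smithNormalFormTopBasis bN hr
  let ab := (Submodule.smithNormalFormBotBasis bN hr).map EK
  let c := Submodule.smithNormalFormCoeffs bN hr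
  have hab (i : Fin 2) : (ab i : V) = c i • (b i : V) := by
    have := congrArg Subtype.val (Submodule.smithNormalFormBotBasis_def bN hr i)
    exact this
  choose n hn hn' using fun i => exists_X_pow_associated
    (Submodule.smithNormalFormCoeffs_ne_zero bN hr i)
  obtain ⟨j', hj', hj⟩ := hasIndex_of_basis (e := e) b
  obtain ⟨k', hk', hk⟩ := hasIndex_of_basis (e := e) ab
  rw [hab, hab, ← algebraMap_smul L⸨X⸩ (c 0), ← algebraMap_smul L⸨X⸩ (c 1), wedge_smul_left,
    wedge_smul_right, HahnSeries.orderTop_mul, HahnSeries.orderTop_mul, hn', hn', hj'] at hk'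
  norm_cast at hk'
  have hidx : k = j + n 0 + n 1 := by
    rw [hN.unique hj, hK.unique hk]
    omega
  let E : (↥N ⧸ K.submoduleOf N) ≃ₗ[L⟦X⟧]
      ((L⟦X⟧ ⧸ Ideal.span {(PowerSeries.X : L⟦X⟧) ^ n 0}) ×
      (L⟦X⟧ ⧸ Ideal.span {(PowerSeries.X : L⟦X⟧) ^ n 1})) :=
    (Submodule.quotientEquivPiSpan _ bN hr).trans
      ((LinearEquiv.piFinTwo L⟦X⟧ _).trans
        ((Submodule.quotEquivOfEq _ _ (hn 0)).prodCongr (Submodule.quotEquivOfEq _ _ (hn 1))))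
  rcases le_total (n 1) (n 0) with h | h
  · exact ⟨n 0, n 1, ⟨h, ⟨E⟩⟩, hidx⟩
  · exact ⟨n 1, n 0, ⟨h, ⟨E.trans (LinearEquiv.prodComm _ _ _)⟩⟩, by omega⟩

end Jordan

/-! ### Lattices in a `φ`-module of rank two in normal form -/

section NormalForm

variable {p : ℕ} [hp : Fact p.Prime] {L : Type*} [Field L] {V : Type*} [AddCommGroup V]
  [Module L⸨X⸩ V] {e : Module.Basis (Fin 2) L⸨X⸩ V} {Φ : V →ₛₗ[phi p L] V} {a : L} {s : ℤ}

/-- `Φ e₀ = e₁` and `Φ e₁ = a u ^ s e₀` with `a ≠ 0`. -/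
structure IsNormalForm (e : Module.Basis (Fin 2) L⸨X⸩ V) (Φ : V →ₛₗ[phi p L] V) (a : L) (s : ℤ) :
    Prop where
  ne_zero : a ≠ 0
  map_zero : Φ (e 0) = e 1
  map_one : Φ (e 1) = (HahnSeries.single s a : L⸨X⸩) • e 0

theorem IsNormalForm.repr_map (h : IsNormalForm e Φ a s) (x : V) :
    e.repr (Φ x) 0 = HahnSeries.single s a * phi p L (e.repr x 1) ∧
      e.repr (Φ x) 1 = phi p L (e.repr x 0) := by
  have : Φ x = phi p L (e.repr x 0) • e 1 +
      phi p L (e.repr x 1) • (HahnSeries.single s a : L⸨X⸩) • e 0 := by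
    conv_lhs => rw [← e.sum_repr x]
    rw [Fin.sum_univ_two, map_add, LinearMap.map_smulₛₗ, LinearMap.map_smulₛₗ, h.map_zero,
      h.map_one]
  rw [this]
  simp [mul_comm]

theorem IsNormalForm.wedge_map_map (h : IsNormalForm e Φ a s) (x y : V) :
    wedge e (Φ x) (Φ y) = -(HahnSeries.single s a * phi p L (wedge e x y)) := by
  simp only [wedge, (h.repr_map _).1, (h.repr_map _).2, map_sub, map_mul]
  ring

theorem IsNormalForm.wedge_map (h : IsNormalForm e Φ a s) (x y : V) :
    wedge e x (Φ y) = e.repr x 0 * phi p L (e.repr y 0) -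
      HahnSeries.single s a * (e.repr x 1 * phi p L (e.repr y 1)) := by
  simp only [wedge, (h.repr_map _).1, (h.repr_map _).2]
  ring

/-- As `p + 1` does not divide `s`, no cancellation can occur in `x ∧ Φ x`. -/
theorem IsNormalForm.le_of_le_orderTop_wedge_map (h : IsNormalForm e Φ a s)
    (hs : ¬ ((p : ℤ) + 1 ∣ s)) (x : V) (k : ℤ) (hk : (k : WithTop ℤ) ≤ (wedge e x (Φ x)).orderTop) :
    (∀ n : ℤ, (e.repr x 0).orderTop = n → k ≤ (p + 1) * n) ∧
      ∀ n : ℤ, (e.repr x 1).orderTop = n → k ≤ (p + 1) * n + s := by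
  rw [h.wedge_map] at hk
  have h0 (n : ℤ) (hn : (e.repr x 0).orderTop = n) :
      (e.repr x 0 * phi p L (e.repr x 0)).orderTop = ((p + 1) * n : ℤ) := by
    rw [HahnSeries.orderTop_mul, orderTop_phi_of_eq p hn, hn]
    norm_cast
    push_cast
    ring
  have h1 (n : ℤ) (hn : (e.repr x 1).orderTop = n) :
      (HahnSeries.single s a * (e.repr x 1 * phi p L (e.repr x 1))).orderTop =
        ((p + 1) * n + s : ℤ) := by
    rw [HahnSeries.orderTop_mul, HahnSeries.orderTop_mul, orderTop_phi_of_eq p hn, hn,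
      HahnSeries.orderTop_single h.ne_zero]
    norm_cast
    push_cast
    ring
  by_cases hx0 : e.repr x 0 = 0
  · refine ⟨fun n hn => by simp [hx0] at hn, fun n hn => ?_⟩
    rw [hx0, zero_mul, zero_sub, HahnSeries.orderTop_neg, h1 n hn] at hk
    exact_mod_cast hk
  by_cases hx1 : e.repr x 1 = 0
  · refine ⟨fun n hn => ?_, fun n hn => by simp [hx1] at hn⟩
    rw [hx1, zero_mul, mul_zero, sub_zero, h0 n hn] at hk
    exact_mod_cast hk
  obtain ⟨n, hn⟩ := WithTop.ne_top_iff_exists.1 (HahnSeries.orderTop_ne_top.2 hx0)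
  obtain ⟨m, hm⟩ := WithTop.ne_top_iff_exists.1 (HahnSeries.orderTop_ne_top.2 hx1)
  -- The two terms of `x ∧ Φ x` have distinct orders, so the order of their difference is the
  -- minimum of the two.
  have hne : ((p : ℤ) + 1) * n ≠ (p + 1) * m + s := fun hnm =>
    hs ⟨n - m, by rw [mul_sub]; omega⟩
  have hord : k ≤ (p + 1) * n ∧ k ≤ (p + 1) * m + s := by
    have hmin := (HahnSeries.addVal ℤ L).map_add_of_distinct_val
      (x := e.repr x 0 * phi p L (e.repr x 0))
      (y := -(HahnSeries.single s a * (e.repr x 1 * phi p L (e.repr x 1)))) (by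
        rw [AddValuation.map_neg, HahnSeries.addVal_apply, HahnSeries.addVal_apply, h0 n hn.symm,
          h1 m hm.symm]
        exact_mod_cast hne)
    rw [AddValuation.map_neg, HahnSeries.addVal_apply, HahnSeries.addVal_apply,
      HahnSeries.addVal_apply, h0 n hn.symm, h1 m hm.symm, ← sub_eq_add_neg] at hmin
    rw [hmin] at hk
    exact_mod_cast le_min_iff.1 hk
  exact ⟨fun n' hn' => by rw [← hn] at hn'; cases hn'; exact hord.1,
    fun n' hn' => by rw [← hm] at hn'; cases hn'; exact hord.2⟩

variable [Module L⟦X⟧ V] [IsScalarTower L⟦X⟧ L⸨X⸩ V]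

/-- This works because `φ` maps `L[[u]]` into itself. -/
theorem span_image_span_pair (x y : V) :
    Submodule.span L⟦X⟧ (Φ '' (Submodule.span L⟦X⟧ {x, y} : Set V)) =
      Submodule.span L⟦X⟧ {Φ x, Φ y} := by
  have hphi (f : L⟦X⟧) : ∃ g : L⟦X⟧, algebraMap L⟦X⟧ L⸨X⸩ g = phi p L (algebraMap L⟦X⟧ L⸨X⸩ f) := by
    refine exists_coe_eq_of_orderTop_nonneg ?_
    have := orderTop_phi_ge p (n := 0) (orderTop_algebraMap_nonneg f)
    simpa using this
  apply le_antisymm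
  · rw [Submodule.span_le]
    rintro _ ⟨z, hz, rfl⟩
    obtain ⟨c, d, rfl⟩ := Submodule.mem_span_pair.1 hz
    obtain ⟨c', hc⟩ := hphi c
    obtain ⟨d', hd⟩ := hphi d
    refine Submodule.mem_span_pair.2 ⟨c', d', ?_⟩
    rw [← algebraMap_smul L⸨X⸩ c, ← algebraMap_smul L⸨X⸩ d, map_add, LinearMap.map_smulₛₗ,
      LinearMap.map_smulₛₗ, ← hc, ← hd, algebraMap_smul, algebraMap_smul]
  · refine Submodule.span_mono ?_
    rintro z (rfl | rfl)
    · exact ⟨x, Submodule.subset_span (by simp), rfl⟩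
    · exact ⟨y, Submodule.subset_span (by simp), rfl⟩

theorem IsNormalForm.hasIndex_span_image (h : IsNormalForm e Φ a s) {𝔐 : Submodule L⟦X⟧ V} {i : ℤ}
    (hM : HasIndex e 𝔐 i) :
    HasIndex e (Submodule.span L⟦X⟧ (Φ '' (𝔐 : Set V))) (s + p * i) := by
  obtain ⟨x, y, rfl, hxy⟩ := hM
  refine ⟨Φ x, Φ y, span_image_span_pair x y, ?_⟩
  rw [h.wedge_map_map, HahnSeries.orderTop_neg, HahnSeries.orderTop_mul,
    orderTop_phi_of_eq p hxy, HahnSeries.orderTop_single h.ne_zero]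
  norm_cast

/-- The lattices `𝔐` such that `u ^ E 𝔐 ⊆ ⟨Φ 𝔐⟩ ⊆ 𝔐` and such that the Jordan type of `u` on
`⟨Φ 𝔐⟩ / u ^ E 𝔐` is at most `(r₁, r₂)`. -/
def boundedLattices (Φ : V →ₛₗ[phi p L] V) (E r₁ r₂ : ℕ) : Set (Submodule L⟦X⟧ V) :=
  {𝔐 | Submodule.IsLattice L⸨X⸩ 𝔐 ∧
    (PowerSeries.X : L⟦X⟧) ^ E • 𝔐 ≤ Submodule.span L⟦X⟧ (Φ '' (𝔐 : Set V)) ∧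
    Submodule.span L⟦X⟧ (Φ '' (𝔐 : Set V)) ≤ 𝔐 ∧
    ∃ a b : ℕ,
      HasJordanType L
        (↥(Submodule.span L⟦X⟧ (Φ '' (𝔐 : Set V))) ⧸
          ((PowerSeries.X : L⟦X⟧) ^ E • 𝔐).submoduleOf
            (Submodule.span L⟦X⟧ (Φ '' (𝔐 : Set V)))) a b ∧
      a ≤ r₁ ∧ a + b = r₁ + r₂}

theorem X_pow_smul_mem_X_pow_smul_iff {𝔐 : Submodule L⟦X⟧ V} {m n : ℕ} (hmn : m ≤ n) (x : V) :
    (PowerSeries.X : L⟦X⟧) ^ m • x ∈ (PowerSeries.X : L⟦X⟧) ^ n • 𝔐 ↔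
      x ∈ (PowerSeries.X : L⟦X⟧) ^ (n - m) • 𝔐 := by
  rw [mem_X_pow_smul_iff, mem_X_pow_smul_iff, ← algebraMap_smul L⸨X⸩ (PowerSeries.X ^ m),
    LaurentSeries.coe_algebraMap, HahnSeries.ofPowerSeries_X_pow, smul_smul,
    HahnSeries.single_mul_single, one_mul]
  rw [show (-(n : ℤ) + m) = -((n - m : ℕ) : ℤ) by omega]

/-- The index equation encodes the total size of the Jordan blocks, and the inclusion encodes the
bound on the largest one. The remaining containments then follow. -/
theorem IsNormalForm.mem_boundedLattices_iff (h : IsNormalForm e Φ a s) {E r₁ r₂ : ℕ} 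
    (hE : r₁ ≤ E) (𝔐 : Submodule L⟦X⟧ V) :
    𝔐 ∈ boundedLattices Φ E r₁ r₂ ↔ ∃ i : ℤ, HasIndex e 𝔐 i ∧
      ((p : ℤ) - 1) * i = 2 * E - (r₁ + r₂) - s ∧
      ∀ x ∈ 𝔐, Φ x ∈ (PowerSeries.X : L⟦X⟧) ^ (E - r₁) • 𝔐 := by
  constructor
  · rintro ⟨hlat, hle, hle', c, d, hJ, hc, hcd⟩
    obtain ⟨i, hi⟩ := exists_hasIndex e 𝔐
    refine ⟨i, hi, ?_, fun x hx => ?_⟩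
    · obtain ⟨c', d', hJ', hidx⟩ :=
        (h.hasIndex_span_image hi).exists_hasJordanType (hi.X_pow_smul E) hle
      have := add_eq_of_linearEquiv (hJ.2.some.symm.trans hJ'.2.some)
      have : (c : ℤ) + d = c' + d' := by exact_mod_cast this
      have : (c : ℤ) + d = r₁ + r₂ := by exact_mod_cast hcd
      linarith
    · rw [← X_pow_smul_mem_X_pow_smul_iff hE]
      exact (X_pow_smul_quotient_eq_zero_iff r₁).1 (hJ.X_pow_smul_eq_zero hc) _
        (Submodule.subset_span ⟨x, hx, rfl⟩)
  · rintro ⟨i, hi, heq, hΦ⟩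
    have hN := h.hasIndex_span_image hi
    set N := Submodule.span L⟦X⟧ (Φ '' (𝔐 : Set V)) with hNdef
    have hNle : N ≤ (PowerSeries.X : L⟦X⟧) ^ (E - r₁) • 𝔐 := by
      rw [hNdef, Submodule.span_le]
      rintro _ ⟨x, hx, rfl⟩
      exact hΦ x hx
    -- By duality it suffices to pair with `N ⊆ u ^ (E - r₁) 𝔐`. The wedge has order at least `2E -
    -- r₁ + i`, while `N` has index `s + p i = 2E - r₁ - r₂ + i`.
    have hKN : (PowerSeries.X : L⟦X⟧) ^ E • 𝔐 ≤ N := by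
      intro x hx
      rw [hN.mem_iff]
      intro w hw
      rw [mem_X_pow_smul_iff] at hx
      have hw' := hNle hw
      rw [mem_X_pow_smul_iff] at hw'
      have := hi.le_orderTop_wedge hw' hx
      rw [wedge_smul_left, wedge_smul_right, HahnSeries.orderTop_mul, HahnSeries.orderTop_mul,
        HahnSeries.orderTop_single one_ne_zero, HahnSeries.orderTop_single one_ne_zero] at this
      generalize (wedge e w x).orderTop = t at this
      induction t with
      | top => simp
      | coe t =>
        norm_cast at this ⊢
        push_cast [hE] at this
        linarith
    refine ⟨hi.isLattice, hKN, hNle.trans fun x hx => ?_, ?_⟩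
    · rw [Submodule.mem_smul_pointwise_iff_exists] at hx
      obtain ⟨y, hy, rfl⟩ := hx
      exact 𝔐.smul_mem _ hy
    · obtain ⟨c, d, hJ, hidx⟩ := hN.exists_hasJordanType (hi.X_pow_smul E) hKN
      refine ⟨c, d, hJ, hJ.le_of_X_pow_smul_eq_zero ?_, ?_⟩
      · rw [X_pow_smul_quotient_eq_zero_iff]
        intro x hx
        rw [X_pow_smul_mem_X_pow_smul_iff hE]
        exact hNle hx
      · zify
        linarith

/-- The lattice `⟨u ^ α e₀, u ^ β e₁⟩`. -/
def standardLattice (e : Module.Basis (Fin 2) L⸨X⸩ V) (α β : ℤ) : Submodule L⟦X⟧ V :=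
  Submodule.span L⟦X⟧ {(HahnSeries.single α (1 : L) : L⸨X⸩) • e 0,
      (HahnSeries.single β (1 : L) : L⸨X⸩) • e 1}

/-- The lattices of index `m` with `Φ 𝔐 ⊆ u ^ A 𝔐` are the sublattices of index `m` of a standard
lattice. -/
theorem IsNormalForm.forall_map_mem_X_pow_smul_iff (h : IsNormalForm e Φ a s)
    (hs : ¬ ((p : ℤ) + 1 ∣ s)) {𝔐 : Submodule L⟦X⟧ V} {m : ℤ} (hm : HasIndex e 𝔐 m) (A : ℕ) :
    (∀ x ∈ 𝔐, Φ x ∈ (PowerSeries.X : L⟦X⟧) ^ A • 𝔐) ↔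
      𝔐 ≤ standardLattice e ⌈((A + m : ℤ) : ℚ) / (p + 1)⌉
        ⌈((A + m - s : ℤ) : ℚ) / (p + 1)⌉ := by
  have hpos : (0 : ℚ) < p + 1 := by positivity
  have hceil (k n : ℤ) : ⌈(k : ℚ) / (p + 1)⌉ ≤ n ↔ k ≤ (p + 1) * n := by
    rw [Int.ceil_le, div_le_iff₀' hpos]
    exact_mod_cast Iff.rfl
  constructor
  · intro H x hx
    rw [standardLattice, mem_span_single_smul_iff]
    -- Only the diagonal pairing of `Φ x` with `x` itself is needed here.
    have := h.le_of_le_orderTop_wedge_map hs x _ ((hm.mem_X_pow_smul_iff A).1 (H x hx) x hx)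
    constructor
    · generalize (e.repr x 0).orderTop = t at this
      induction t with
      | top => simp
      | coe t =>
        rw [WithTop.coe_le_coe, hceil]
        exact this.1 t rfl
    · generalize (e.repr x 1).orderTop = t at this
      induction t with
      | top => simp
      | coe t =>
        rw [WithTop.coe_le_coe, hceil]
        linarith [this.2 t rfl]
  · intro H x hx
    rw [hm.mem_X_pow_smul_iff]
    intro w hw
    have hx' := (mem_span_single_smul_iff _ _ _).1 (H hx)
    have hw' := (mem_span_single_smul_iff _ _ _).1 (H hw)
    set α := ⌈((A + m : ℤ) : ℚ) / (p + 1)⌉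
    set β := ⌈((A + m - s : ℤ) : ℚ) / (p + 1)⌉
    have hα := (hceil (A + m) α).1 le_rfl
    have hβ := (hceil (A + m - s) β).1 le_rfl
    rw [h.wedge_map]
    -- The two terms of `w ∧ Φ x` have orders at least `(p + 1) α` and `(p + 1) β + s`, both at
    -- least `A + m` by the choice of ceilings.
    refine orderTop_sub_ge ?_ ?_
    · refine le_trans ?_ (orderTop_mul_ge hw'.1 (orderTop_phi_ge p hx'.1))
      norm_cast
      linarith
    · refine le_trans ?_ (orderTop_mul_ge (HahnSeries.orderTop_single h.ne_zero).ge
        (orderTop_mul_ge hw'.2 (orderTop_phi_ge p hx'.2)))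
      norm_cast
      linarith

end NormalForm

/-! ### Descent of the normal form -/

theorem coeffMap_single {F L : Type*} [Field F] [Field L] (f : F →+* L) (n : ℤ) (a : F) :
    coeffMap f (HahnSeries.single n a) = HahnSeries.single n (f a) := by
  ext k
  rw [coeffMap_coeff, HahnSeries.coeff_single, HahnSeries.coeff_single]
  split_ifs <;> simp

section Contract

variable {F : Type*} [Field F] {L : Type*} [Field L] [Algebra F L] {M : Type*} [AddCommGroup M]
  [Module F⸨X⸩ M]

/-- The map `L((u)) → F((u))` applying an `F`-linear form to all coefficients. -/
def coeffForm (g : L →ₗ[F] F) : L⸨X⸩ →+ F⸨X⸩ where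
  toFun x := HahnSeries.map x (g : L →+ F)
  map_zero' := HahnSeries.map_zero ((g : L →+ F) : ZeroHom L F)
  map_add' x y := by ext; simp

theorem coeffForm_coeff (g : L →ₗ[F] F) (x : L⸨X⸩) (n : ℤ) :
    (coeffForm g x).coeff n = g (x.coeff n) := rfl

theorem coeffForm_coeffMap_mul (g : L →ₗ[F] F) (c : F⸨X⸩) (x : L⸨X⸩) :
    coeffForm g (coeffMap (algebraMap F L) c * x) = c * coeffForm g x := by
  ext n
  rw [coeffForm_coeff, HahnSeries.coeff_mul_left' (s := c.support) c.isPWO_support,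
    HahnSeries.coeff_mul_right' (s := x.support) x.isPWO_support, map_sum]
  · refine Finset.sum_congr rfl fun ij _ => ?_
    rw [coeffMap_coeff, coeffForm_coeff, ← Algebra.smul_def, map_smul, smul_eq_mul]
  · intro j hj hj0
    exact hj (by rw [coeffForm_coeff, hj0, map_zero])
  · intro j hj hj0
    exact hj (by rw [coeffMap_coeff, hj0, map_zero])

theorem coeffForm_phi (p : ℕ) [Fact p.Prime] (g : L →ₗ[F] F) (x : L⸨X⸩) :
    coeffForm g (phi p L x) = phi p F (coeffForm g x) := by
  ext n
  by_cases hn : (p : ℤ) ∣ n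
  · obtain ⟨k, rfl⟩ := hn
    rw [phi_coeff_mul, coeffForm_coeff, coeffForm_coeff, phi_coeff_mul]
  · rw [phi_coeff_of_not_dvd _ _ _ _ hn, coeffForm_coeff, phi_coeff_of_not_dvd _ _ _ _ hn,
      map_zero]

theorem coeffForm_single (g : L →ₗ[F] F) (n : ℤ) (a : L) :
    coeffForm g (HahnSeries.single n a) = HahnSeries.single n (g a) := by
  ext k
  rw [coeffForm_coeff, HahnSeries.coeff_single, HahnSeries.coeff_single]
  split_ifs <;> simp

/-- The map `M_L → M`, `x ⊗ m ↦ g(x) m`, induced by a linear form `g : L → F`. -/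
def contract (g : L →ₗ[F] F) : BaseChange F L M →+ M :=
  letI := coeffAlgebra F L
  letI G : L⸨X⸩ →ₗ[F⸨X⸩] F⸨X⸩ :=
    { coeffForm g with
      map_smul' := fun c x => by
        rw [Algebra.smul_def]
        exact coeffForm_coeffMap_mul g c x }
  (TensorProduct.lift ((LinearMap.lsmul F⸨X⸩ M : F⸨X⸩ →ₗ[F⸨X⸩] M →ₗ[F⸨X⸩] M).comp G) :
    L⸨X⸩ ⊗[F⸨X⸩] M →ₗ[F⸨X⸩] M).toAddMonoidHom

theorem contract_tmul (g : L →ₗ[F] F) (x : L⸨X⸩) (m : M) :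
    contract g (tmul x m) = coeffForm g x • m := rfl

theorem contract_smul (g : L →ₗ[F] F) (c : F⸨X⸩) (z : BaseChange F L M) :
    contract g (coeffMap (algebraMap F L) c • z) = c • contract g z := by
  induction z using BaseChange.induction_on with
  | zero => simp
  | tmul x m => rw [smul_tmul, contract_tmul, contract_tmul, coeffForm_coeffMap_mul, mul_smul]
  | add x y hx hy => rw [smul_add, map_add, map_add, hx, hy, smul_add]

/-- A linear form on coefficients commutes with `φ`, which only moves exponents. Contraction thus
carries eigenvectors of iterates of `Φ` from `M_L` down to `M`. -/
theorem contract_Phi {p : ℕ} [Fact p.Prime] (Φ : M →ₛₗ[phi p F] M) (g : L →ₗ[F] F)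
    (z : BaseChange F L M) : contract g (Phi Φ L z) = Φ (contract g z) := by
  induction z using BaseChange.induction_on with
  | zero => simp
  | tmul x m => rw [Phi_tmul, contract_tmul, contract_tmul, coeffForm_phi, LinearMap.map_smulₛₗ]
  | add x y hx hy => rw [map_add, map_add, map_add, hx, hy, map_add]

theorem tmul_add (x : L⸨X⸩) (m n : M) :
    (tmul x (m + n) : BaseChange F L M) = tmul x m + tmul x n :=
  letI := coeffAlgebra F L
  TensorProduct.tmul_add x m n

theorem add_tmul (x y : L⸨X⸩) (m : M) :
    (tmul (x + y) m : BaseChange F L M) = tmul x m + tmul y m :=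
  letI := coeffAlgebra F L
  TensorProduct.add_tmul x y m

theorem tmul_smul (x : L⸨X⸩) (c : F⸨X⸩) (m : M) :
    (tmul x (c • m) : BaseChange F L M) = coeffMap (algebraMap F L) c • tmul x m :=
  letI := coeffAlgebra F L
  (TensorProduct.smul_tmul c x m).symm

/-- The additive map `x ↦ x ⊗ m`. -/
def tmulHom (F : Type*) [Field F] [Algebra F L] [Module F⸨X⸩ M] (m : M) :
    L⸨X⸩ →+ BaseChange F L M where
  toFun x := tmul x m
  map_zero' := letI := coeffAlgebra F L; TensorProduct.zero_tmul _ m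
  map_add' x y := add_tmul x y m

/-- Expansion in a basis of `L` over `F`. It shows that a nonzero vector has some nonzero
contraction. -/
theorem sum_smul_tmul_contract {ι : Type*} [Fintype ι] (c : Module.Basis ι F L)
    (z : BaseChange F L M) :
    ∑ i, (HahnSeries.C (c i) : L⸨X⸩) • tmul 1 (contract (c.coord i) z) = z := by
  induction z using BaseChange.induction_on with
  | zero =>
    refine Finset.sum_eq_zero fun i _ => ?_
    rw [map_zero, ← zero_smul F⸨X⸩ (0 : M), tmul_smul, map_zero, zero_smul, smul_zero]
  | tmul x m =>
    have hx : ∑ i, HahnSeries.C (c i) * coeffMap (algebraMap F L) (coeffForm (c.coord i) x) = x := by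
      ext n
      rw [HahnSeries.coeff_sum]
      conv_rhs => rw [← c.sum_repr (x.coeff n)]
      refine Finset.sum_congr rfl fun i _ => ?_
      rw [HahnSeries.C_mul_eq_smul, HahnSeries.coeff_smul, coeffMap_coeff, coeffForm_coeff,
        smul_eq_mul, mul_comm, ← Algebra.smul_def, c.coord_apply]
    conv_rhs => rw [← hx]
    refine Eq.trans ?_ (map_sum (tmulHom F m) _ _).symm
    refine Finset.sum_congr rfl fun i _ => ?_
    rw [contract_tmul, tmul_smul, smul_tmul, smul_tmul, mul_one]
    rfl
  | add x y hx hy =>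
    conv_rhs => rw [← hx, ← hy]
    rw [← Finset.sum_add_distrib]
    refine Finset.sum_congr rfl fun i _ => ?_
    rw [map_add, tmul_add, smul_add]

theorem exists_contract_ne_zero [FiniteDimensional F L] {z : BaseChange F L M} (hz : z ≠ 0) :
    ∃ g : L →ₗ[F] F, contract g z ≠ 0 := by
  by_contra! h
  apply hz
  rw [← sum_smul_tmul_contract (Module.finBasis F L) z]
  refine Finset.sum_eq_zero fun i _ => ?_
  rw [h, ← zero_smul F⸨X⸩ (0 : M), tmul_smul, map_zero, zero_smul, smul_zero]

end Contract

/-! ### Eigenvectors of iterates of `Φ` -/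

section Iterate

variable {p : ℕ} [hp : Fact p.Prime] {L : Type*} [Field L] {V : Type*} [AddCommGroup V]
  [Module L⸨X⸩ V] {e : Module.Basis (Fin 2) L⸨X⸩ V} {Φ : V →ₛₗ[phi p L] V} {a : L} {s : ℤ}

theorem iterate_smul (k : ℕ) (c : L⸨X⸩) (x : V) :
    Φ^[k] (c • x) = (phi p L)^[k] c • Φ^[k] x := by
  induction k with
  | zero => rfl
  | succ k ih =>
    rw [Function.iterate_succ_apply', Function.iterate_succ_apply', Function.iterate_succ_apply',
      ih, LinearMap.map_smulₛₗ]

theorem orderTop_iterate_phi {x : L⸨X⸩} {n : ℤ} (hx : x.orderTop = n) (k : ℕ) :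
    ((phi p L)^[k] x).orderTop = (p ^ k * n : ℤ) := by
  induction k with
  | zero => simpa using hx
  | succ k ih =>
    rw [Function.iterate_succ_apply', orderTop_phi_of_eq p ih, ← mul_assoc, ← pow_succ']

/-- The iterate multiplies orders by `p ^ k`, so a nonzero fixed series has order `0`. Subtracting
the constant term, itself fixed, leaves nothing. -/
theorem eq_C_of_iterate_phi_eq {k : ℕ} (hk : k ≠ 0) {x : L⸨X⸩} (hx : (phi p L)^[k] x = x) :
    x = HahnSeries.C (x.coeff 0) := by
  have hC (b : L) : phi p L (HahnSeries.C b) = HahnSeries.C b := by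
    rw [HahnSeries.C_apply, phi_single, mul_zero]
  have hy : (phi p L)^[k] (x - HahnSeries.C (x.coeff 0)) = x - HahnSeries.C (x.coeff 0) := by
    rw [iterate_map_sub, hx, Function.iterate_fixed (hC _)]
  by_contra h
  have h0 := sub_ne_zero.2 h
  obtain ⟨n, hn⟩ := WithTop.ne_top_iff_exists.1 (HahnSeries.orderTop_ne_top.2 h0)
  have h1 := orderTop_iterate_phi (p := p) hn.symm k
  rw [hy, ← hn] at h1
  have h2 : n = (p : ℤ) ^ k * n := by exact_mod_cast h1
  have h3 : (1 : ℤ) < (p : ℤ) ^ k := one_lt_pow₀ (by exact_mod_cast hp.out.one_lt) hk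
  have h4 : n = 0 := by
    have : ((p : ℤ) ^ k - 1) * n = 0 := by linarith
    exact (mul_eq_zero.1 this).resolve_left (by omega)
  refine HahnSeries.coeff_orderTop_ne hn.symm ?_
  simp [h4]

namespace IsNormalForm

theorem iterate_basis_zero (h : IsNormalForm e Φ a s) (n : ℕ) :
    ∃ c : ℤ, ((p : ℤ) ^ 2 - 1) * c = s * ((p : ℤ) ^ (2 * n) - 1) ∧
      Φ^[2 * n] (e 0) = (HahnSeries.single c (a ^ n) : L⸨X⸩) • e 0 := by
  induction n with
  | zero => exact ⟨0, by simp, by simp⟩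
  | succ n ih =>
    obtain ⟨c, hc, hn⟩ := ih
    -- Applying `Φ` twice sends the exponent `c` to `p² c + s`, whose solution from `0` is `s (p ^
    -- (2n) - 1) / (p² - 1)`.
    refine ⟨p * (p * c) + s, by linear_combination (p : ℤ) ^ 2 * hc, ?_⟩
    rw [show 2 * (n + 1) = 2 * n + 1 + 1 by ring, Function.iterate_succ_apply',
      Function.iterate_succ_apply', hn, LinearMap.map_smulₛₗ, LinearMap.map_smulₛₗ, h.map_zero,
      h.map_one, smul_smul, phi_single, phi_single, HahnSeries.single_mul_single, pow_succ]

/-- A vector on which a power of `Φ ^ 2` acts by the same scalar as on `e₀` is a constant multiple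
of `e₀`. -/
theorem eq_C_smul_of_iterate_eq (h : IsNormalForm e Φ a s) (hs : ¬ ((p : ℤ) + 1 ∣ s)) {n : ℕ}
    (hn : n ≠ 0) {c : ℤ} (hc : ((p : ℤ) ^ 2 - 1) * c = s * ((p : ℤ) ^ (2 * n) - 1))
    (he : Φ^[2 * n] (e 0) = (HahnSeries.single c 1 : L⸨X⸩) • e 0) {y : V}
    (hy : Φ^[2 * n] y = (HahnSeries.single c 1 : L⸨X⸩) • y) :
    ∃ b : L, y = (HahnSeries.C b : L⸨X⸩) • e 0 := by
  have he1 : Φ^[2 * n] (e 1) = (HahnSeries.single (p * c) 1 : L⸨X⸩) • e 1 := by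
    rw [← h.map_zero, ← Function.iterate_succ_apply, Function.iterate_succ_apply', he,
      LinearMap.map_smulₛₗ, phi_single]
  have hy' : Φ^[2 * n] y = (phi p L)^[2 * n] (e.repr y 0) • (HahnSeries.single c 1 : L⸨X⸩) • e 0 +
      (phi p L)^[2 * n] (e.repr y 1) • (HahnSeries.single (p * c) 1 : L⸨X⸩) • e 1 := by
    conv_lhs => rw [← e.sum_repr y]
    rw [Fin.sum_univ_two, iterate_map_add, iterate_smul, iterate_smul, he, he1]
  rw [hy] at hy'
  have h0 := congrArg (fun v => e.repr v 0) hy'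
  have h1 := congrArg (fun v => e.repr v 1) hy'
  simp at h0 h1
  have hp1 : (1 : ℤ) < p := by exact_mod_cast hp.out.one_lt
  have hpn : (1 : ℤ) < (p : ℤ) ^ (2 * n) := one_lt_pow₀ hp1 (by omega)
  -- If the `e₁`-coordinate had order `k`, comparing orders would force `(p + 1) k + s = 0`, against
  -- `p + 1 ∤ s`.
  have hy1 : e.repr y 1 = 0 := by
    by_contra hne
    obtain ⟨k, hk⟩ := WithTop.ne_top_iff_exists.1 (HahnSeries.orderTop_ne_top.2 hne)
    have h2 := congrArg HahnSeries.orderTop h1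
    rw [HahnSeries.orderTop_mul, HahnSeries.orderTop_mul, HahnSeries.orderTop_single one_ne_zero,
      HahnSeries.orderTop_single one_ne_zero, orderTop_iterate_phi hk.symm, ← hk] at h2
    have h3 : c + k = (p : ℤ) ^ (2 * n) * k + p * c := by exact_mod_cast h2
    have h4 : ((p : ℤ) ^ (2 * n) - 1) * ((p + 1) * k + s) = 0 := by
      linear_combination -(p + 1 : ℤ) * h3 - hc
    have h5 := (mul_eq_zero.1 h4).resolve_left (by omega)
    exact hs ⟨-k, by linarith⟩
  have hy0 : (phi p L)^[2 * n] (e.repr y 0) = e.repr y 0 := by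
    rw [mul_comm] at h0
    exact (mul_right_cancel₀ (by simp) h0).symm
  refine ⟨(e.repr y 0).coeff 0, ?_⟩
  rw [← eq_C_of_iterate_phi_eq (by omega) hy0]
  conv_lhs => rw [← e.sum_repr y]
  rw [Fin.sum_univ_two, hy1, zero_smul, add_zero]

end IsNormalForm

end Iterate

/-! ### Descent of the normal form to the ground field -/

section Descent

variable {p : ℕ} [hp : Fact p.Prime] {F : Type u} [Field F] {M : Type w} [AddCommGroup M]
  [Module F⸨X⸩ M] {Φ : M →ₛₗ[phi p F] M} {s : ℤ}

/-- Since `L` is finite, `a` is a root of unity, and some iterate of `Φ` scales `e₀` by a pure power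
of `u`, which is defined over `F`. A nonzero contraction `m` of `e₀` is scaled alike, so `1 ⊗ m` is
a constant multiple of `e₀`, and `m, Φ m` is the required basis of `M`. -/
theorem HasNormalForm.exists_isNormalForm [Finite F] (hM : Module.finrank F⸨X⸩ M = 2)
    (h : HasNormalForm Φ s) :
    ∃ (b : Module.Basis (Fin 2) F⸨X⸩ M) (a : F), IsNormalForm b Φ a s := by
  obtain ⟨-, -, hs, L, _, _, _, e, a, ha, h0, h1⟩ := h
  have he : IsNormalForm e (Phi Φ L) a s := ⟨ha, h0, h1⟩
  have : Finite L := Module.finite_of_finite F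
  obtain ⟨n, hn, han⟩ : ∃ n : ℕ, n ≠ 0 ∧ a ^ n = 1 := by
    obtain ⟨n, hn, h⟩ := isOfFinOrder_iff_pow_eq_one.1 (isOfFinOrder_of_finite (Units.mk0 a ha))
    exact ⟨n, hn.ne', by simpa using congrArg Units.val h⟩
  obtain ⟨c, hc, hec⟩ := he.iterate_basis_zero n
  rw [han] at hec
  obtain ⟨g, hg⟩ := exists_contract_ne_zero (e.ne_zero 0)
  set m : M := contract g (e 0) with hm
  have hsingle : (HahnSeries.single c 1 : L⸨X⸩) = coeffMap (algebraMap F L) (HahnSeries.single c 1) := by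
    rw [coeffMap_single, map_one (algebraMap F L)]
  have hmc : Φ^[2 * n] m = (HahnSeries.single c 1 : F⸨X⸩) • m := by
    rw [hm, ← contract_smul, ← hsingle, ← hec]
    exact ((Function.Semiconj.iterate_right (f := contract g) (ga := Phi Φ L) (gb := Φ)
      (fun z => contract_Phi Φ g z) (2 * n)) (e 0)).symm
  have hΦ1 (x : M) : Phi Φ L (tmul 1 x) = tmul 1 (Φ x) := by rw [Phi_tmul, map_one]
  have hyc : (Phi Φ L)^[2 * n] (tmul 1 m) = (HahnSeries.single c 1 : L⸨X⸩) • tmul 1 m := by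
    rw [hsingle, ← tmul_smul, ← hmc]
    exact ((Function.Semiconj.iterate_right (f := fun x : M => (tmul 1 x : BaseChange F L M))
      (ga := Φ) (gb := Phi Φ L) (fun z => (hΦ1 z).symm) (2 * n)) m).symm
  obtain ⟨b, hb⟩ := he.eq_C_smul_of_iterate_eq hs hn hc hec hyc
  -- An `F`-linear retraction of `F → L` recovers `x` from `1 ⊗ x`, and so brings identities in
  -- `M_L` back to `M`.
  obtain ⟨g₁, hg₁⟩ : ∃ g₁ : L →ₗ[F] F, g₁ 1 = 1 := by
    obtain ⟨g₁, hg₁⟩ := (Algebra.linearMap F L).exists_leftInverse_of_injective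
      (LinearMap.ker_eq_bot.2 (algebraMap F L).injective)
    exact ⟨g₁, by simpa using LinearMap.congr_fun hg₁ 1⟩
  have hcontract (x : M) : contract g₁ (tmul (1 : L⸨X⸩) x) = x := by
    rw [contract_tmul, ← HahnSeries.single_zero_one, coeffForm_single, hg₁,
      HahnSeries.single_zero_one, one_smul]
  have hb0 : b ≠ 0 := by
    rintro rfl
    rw [map_zero, zero_smul] at hb
    have := hcontract m
    rw [hb, map_zero] at this
    exact hg this.symm
  have hCb : phi p L (HahnSeries.C b) = HahnSeries.C b := by
    rw [HahnSeries.C_apply, phi_single, mul_zero]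
  have hΦy : (tmul 1 (Φ m) : BaseChange F L M) = (HahnSeries.C b : L⸨X⸩) • e 1 := by
    rw [← hΦ1, hb, LinearMap.map_smulₛₗ, hCb, h0]
  have hΦΦy : (tmul 1 (Φ (Φ m)) : BaseChange F L M) = (HahnSeries.single s a : L⸨X⸩) • tmul 1 m := by
    rw [← hΦ1, hΦy, LinearMap.map_smulₛₗ, hCb, h1, hb, smul_comm]
  have hΦΦ : Φ (Φ m) = (HahnSeries.single s (g₁ a) : F⸨X⸩) • m := by
    rw [← hcontract (Φ (Φ m)), hΦΦy, smul_tmul, mul_one, contract_tmul, coeffForm_single]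
  have hli : LinearIndependent F⸨X⸩ ![m, Φ m] := by
    rw [LinearIndependent.pair_iff]
    intro x y hxy
    have hxy' : coeffMap (algebraMap F L) x • (HahnSeries.C b : L⸨X⸩) • e 0 +
        coeffMap (algebraMap F L) y • (HahnSeries.C b : L⸨X⸩) • e 1 = 0 := by
      rw [← hb, ← hΦy, ← tmul_smul, ← tmul_smul, ← tmul_add, hxy, ← zero_smul F⸨X⸩ (0 : M),
        tmul_smul, map_zero, zero_smul]
    have hx := congrArg (fun v => e.repr v 0) hxy'
    have hy := congrArg (fun v => e.repr v 1) hxy'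
    simpa [hb0] using And.intro hx hy
  let B := basisOfLinearIndependentOfCardEqFinrank hli (by simp [hM])
  have hB0 : B 0 = m := by simp [B]
  have hB1 : B 1 = Φ m := by simp [B]
  refine ⟨B, g₁ a, ?_, by rw [hB0, hB1], by rw [hB0, hB1, hΦΦ]⟩
  intro hga
  rw [hga, map_zero, zero_smul] at hΦΦ
  rw [hΦΦ, ← zero_smul F⸨X⸩ (0 : M), tmul_smul, map_zero, zero_smul, hb, smul_smul] at hΦΦy
  have := congrArg (fun v => e.repr v 0) hΦΦy
  simp at this
  exact HahnSeries.single_ne_zero (mul_ne_zero ha hb0) this.symm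

theorem IsNormalForm.exists_baseChange {b : Module.Basis (Fin 2) F⸨X⸩ M} {a : F}
    (h : IsNormalForm b Φ a s) (L : Type*) [Field L] [Algebra F L] :
    ∃ e : Module.Basis (Fin 2) L⸨X⸩ (BaseChange F L M),
      IsNormalForm e (Phi Φ L) (algebraMap F L a) s := by
  let := coeffAlgebra F L
  let e : Module.Basis (Fin 2) L⸨X⸩ (BaseChange F L M) := b.baseChange L⸨X⸩
  have he (i : Fin 2) : e i = tmul 1 (b i) := b.baseChange_apply L⸨X⸩ i
  refine ⟨e, (map_ne_zero _).2 h.ne_zero, ?_, ?_⟩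
  · rw [he, he, Phi_tmul, _root_.map_one (phi p L), h.map_zero]
  · rw [he, he, Phi_tmul, _root_.map_one (phi p L), h.map_one, tmul_smul, coeffMap_single]

end Descent

/-! ### Schemes with few points over finite extensions -/

section SchemePoints

variable {F : Type u} [Field F] {Z : Scheme.{u}} {π : Z ⟶ Spec (CommRingCat.of F)}

/-- The image of a point under a field extension. -/
def Points.extend {K K' : Type u} [Field K] [Algebra F K] [Field K'] [Algebra F K']
    (f : K →ₐ[F] K') (g : Points π K) : Points π K' :=
  ⟨Spec.map (CommRingCat.ofHom (f : K →+* K')) ≫ g.1, by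
    rw [Category.assoc, g.2, ← Spec.map_comp, ← CommRingCat.ofHom_comp, AlgHom.comp_algebraMap]⟩

/-- Nullstellensatz: the residue field of a closed point is finite over `F`. -/
theorem exists_point_of_isClosed [LocallyOfFiniteType π] {x : Z} (hx : IsClosed {x}) :
    ∃ (K : Type u) (_ : Field K) (_ : Algebra F K) (_ : FiniteDimensional F K) (g : Points π K),
      IsClosedImmersion g.1 ∧ Set.range g.1 = {x} := by
  have hclosed := isClosed_singleton_iff_isClosedImmersion.1 hx
  have hfin : IsFinite (Z.fromSpecResidueField x ≫ π) := by
    rw [isFinite_iff_locallyOfFiniteType_of_jacobsonSpace]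
    infer_instance
  obtain ⟨ψ, hψ⟩ := Spec.map_surjective (Z.fromSpecResidueField x ≫ π)
  rw [← hψ, IsFinite.SpecMap_iff] at hfin
  let := ψ.hom.toAlgebra
  exact ⟨Z.residueField x, inferInstance, ψ.hom.toAlgebra, hfin,
    ⟨Z.fromSpecResidueField x, hψ.symm⟩, hclosed, Z.range_fromSpecResidueField x⟩

theorem exists_common_extension (F K₁ K₂ : Type u) [Field F] [Field K₁] [Algebra F K₁]
    [FiniteDimensional F K₁] [Field K₂] [Algebra F K₂] [FiniteDimensional F K₂] :
    ∃ (K : Type u) (_ : Field K) (_ : Algebra F K) (_ : FiniteDimensional F K),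
      Nonempty (K₁ →ₐ[F] K) ∧ Nonempty (K₂ →ₐ[F] K) := by
  obtain ⟨m, hm⟩ := Ideal.exists_maximal (K₁ ⊗[F] K₂)
  let := Ideal.Quotient.field m
  exact ⟨(K₁ ⊗[F] K₂) ⧸ m, inferInstance, inferInstance,
    inferInstanceAs (Module.Finite F ((K₁ ⊗[F] K₂) ⧸ m)),
    ⟨(Ideal.Quotient.mkₐ F m).comp Algebra.TensorProduct.includeLeft⟩,
    ⟨(Ideal.Quotient.mkₐ F m).comp Algebra.TensorProduct.includeRight⟩⟩

/-- Two closed points give points over a common finite extension, where they must agree. In a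
Jacobson space the closed points are dense. -/
theorem subsingleton_of_subsingleton_points [LocallyOfFiniteType π]
    (h : ∀ (K : Type u) [Field K] [Algebra F K] [FiniteDimensional F K],
      Subsingleton (Points π K)) : Subsingleton Z := by
  have : JacobsonSpace Z := LocallyOfFiniteType.jacobsonSpace π
  have hclosed : (closedPoints Z).Subsingleton := by
    intro x hx y hy
    obtain ⟨K₁, _, _, _, g₁, -, hg₁⟩ := exists_point_of_isClosed (π := π) hx
    obtain ⟨K₂, _, _, _, g₂, -, hg₂⟩ := exists_point_of_isClosed (π := π) hy
    obtain ⟨K, _, _, _, ⟨f₁⟩, ⟨f₂⟩⟩ := exists_common_extension F K₁ K₂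
    have heq := congrArg Subtype.val ((h K).elim (g₁.extend f₁) (g₂.extend f₂))
    let t : Spec (CommRingCat.of K) := IsLocalRing.closedPoint K
    have h1 : (g₁.extend f₁).1 t ∈ Set.range g₁.1 := by
      simp [Points.extend]
    have h2 : (g₂.extend f₂).1 t ∈ Set.range g₂.1 := by
      simp [Points.extend]
    rw [hg₁] at h1
    rw [hg₂, ← heq] at h2
    exact h1.symm.trans h2
  have hcl := closure_closedPoints (X := Z)
  rcases hclosed.eq_empty_or_singleton with h0 | ⟨x, h0⟩
  · rw [h0, closure_empty] at hcl
    exact Set.univ_eq_empty_iff.1 hcl.symm |>.instSubsingleton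
  · have hx : x ∈ closedPoints Z := by rw [h0]; rfl
    rw [h0, IsClosed.closure_eq hx] at hcl
    exact Set.subsingleton_univ_iff.1 (hcl ▸ Set.subsingleton_singleton)

/-- The inclusion of the unique point is a surjective closed immersion into a reduced scheme, hence
an isomorphism. -/
theorem exists_isIso_point [LocallyOfFiniteType π] [IsReduced Z] [Subsingleton Z] [Nonempty Z] :
    ∃ (K : Type u) (_ : Field K) (_ : Algebra F K) (_ : FiniteDimensional F K) (g : Points π K),
      IsIso g.1 := by
  obtain ⟨x⟩ := ‹Nonempty Z›
  have hx : IsClosed ({x} : Set Z) := Set.Subsingleton.isClosed Set.subsingleton_of_subsingleton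
  obtain ⟨K, _, _, _, g, hg, hr⟩ := exists_point_of_isClosed (π := π) hx
  refine ⟨K, _, _, ‹_›, g, ?_⟩
  have : Surjective g.1 := ⟨fun y => by
    have : y ∈ Set.range g.1 := by rw [hr]; exact Subsingleton.elim y x
    exact this⟩
  exact isIso_of_isClosedImmersion_of_surjective g.1

theorem isIso_of_subsingleton [LocallyOfFiniteType π] [IsReduced Z] [Subsingleton Z]
    (σ : Points π F) : IsIso π := by
  have : Nonempty Z := ⟨σ.1 (IsLocalRing.closedPoint F)⟩
  obtain ⟨K, _, _, _, ⟨g, hgπ⟩, hg⟩ := exists_isIso_point (π := π)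
  dsimp only at hg
  have hσ : σ.1 ≫ π = 𝟙 _ := by
    rw [σ.2]
    exact Spec.map_id _
  obtain ⟨ψ, hψ⟩ := Spec.map_surjective (σ.1 ≫ inv g)
  have h1 : CommRingCat.ofHom (algebraMap F K) ≫ ψ = 𝟙 _ := by
    apply Spec.map_injective
    rw [Spec.map_comp, hψ, ← hgπ, Category.assoc, IsIso.inv_hom_id_assoc, hσ, Spec.map_id]
  -- The rational point gives a retraction `K → F` of `F → K`. Being injective, as a map of fields,
  -- it is a two-sided inverse.
  have h2 : ψ ≫ CommRingCat.ofHom (algebraMap F K) = 𝟙 _ := by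
    ext x
    apply ψ.hom.injective
    exact congrArg (fun f => f.hom (ψ.hom x)) h1
  refine ⟨σ.1, ?_, hσ⟩
  rw [← cancel_epi g, ← Category.assoc, hgπ, ← cancel_mono (inv g), Category.assoc, ← hψ,
    ← Spec.map_comp, h2]
  simp

theorem nonempty_unique_points_of_isIso [IsIso π] (K : Type u) [Field K] [Algebra F K] :
    Nonempty (Unique (Points π K)) :=
  ⟨⟨⟨⟨Spec.map (CommRingCat.ofHom (algebraMap F K)) ≫ inv π, by simp⟩⟩, fun g =>
    Subtype.ext (by simp [← g.2])⟩⟩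

end SchemePoints

/-! ### Counting bounded lattices -/

section Count

variable {p : ℕ} [hp : Fact p.Prime] {L : Type*} [Field L] {V : Type*} [AddCommGroup V]
  [Module L⸨X⸩ V] [Module L⟦X⟧ V] [IsScalarTower L⟦X⟧ L⸨X⸩ V]
  {e : Module.Basis (Fin 2) L⸨X⸩ V} {Φ : V →ₛₗ[phi p L] V} {a : L} {s : ℤ}

theorem standardLattice_le {α β α' β' : ℤ} (hα : α ≤ α') (hβ : β ≤ β') :
    standardLattice e α' β' ≤ standardLattice e α β := by
  intro x hx
  rw [standardLattice, mem_span_single_smul_iff] at hx ⊢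
  exact ⟨le_trans (by exact_mod_cast hα) hx.1, le_trans (by exact_mod_cast hβ) hx.2⟩

theorem le_of_standardLattice_le {α β α' β' : ℤ}
    (h : standardLattice e α' β' ≤ standardLattice e α β) : α ≤ α' := by
  have := h (Submodule.subset_span (Set.mem_insert _ _))
  rw [standardLattice, mem_span_single_smul_iff] at this
  have := this.1
  simp only [map_smul, Module.Basis.repr_self, Finsupp.smul_single, smul_eq_mul, mul_one,
    Finsupp.single_eq_same, HahnSeries.orderTop_single (one_ne_zero (α := L))] at this
  exact_mod_cast this

/-- The exponent `⌈k / (p + 1)⌉`. -/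
def ceilExponent (p : ℕ) (k : ℤ) : ℤ := ⌈(k : ℚ) / (p + 1)⌉

theorem IsNormalForm.mem_boundedLattices_iff_le (h : IsNormalForm e Φ a s)
    (hs : ¬ ((p : ℤ) + 1 ∣ s)) {E r₁ r₂ : ℕ} (hE : r₁ ≤ E) (𝔐 : Submodule L⟦X⟧ V) :
    𝔐 ∈ boundedLattices Φ E r₁ r₂ ↔ ∃ m : ℤ, HasIndex e 𝔐 m ∧
      ((p : ℤ) - 1) * m = 2 * E - (r₁ + r₂) - s ∧
      𝔐 ≤ standardLattice e (ceilExponent p (E - r₁ + m)) (ceilExponent p (E - r₁ + m - s)) := by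
  rw [h.mem_boundedLattices_iff hE]
  refine exists_congr fun m => and_congr_right fun hm => and_congr_right fun _ => ?_
  rw [h.forall_map_mem_X_pow_smul_iff hs hm, Nat.cast_sub hE]
  rfl

theorem IsNormalForm.boundedLattices_nonempty_iff (h : IsNormalForm e Φ a s)
    (hs : ¬ ((p : ℤ) + 1 ∣ s)) {E r₁ r₂ : ℕ} (hE : r₁ ≤ E) :
    (boundedLattices Φ E r₁ r₂).Nonempty ↔ ∃ m : ℤ,
      ((p : ℤ) - 1) * m = 2 * E - (r₁ + r₂) - s ∧
      ceilExponent p (E - r₁ + m) + ceilExponent p (E - r₁ + m - s) ≤ m := by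
  constructor
  · rintro ⟨𝔐, h𝔐⟩
    obtain ⟨m, hm, heq, hle⟩ := (h.mem_boundedLattices_iff_le hs hE 𝔐).1 h𝔐
    exact ⟨m, heq, hm.le_of_le (hasIndex_span_single_smul e _ _) hle⟩
  · rintro ⟨m, heq, hle⟩
    -- All the slack in the index is put on the `e₀`-exponent.
    refine ⟨standardLattice e (m - ceilExponent p (E - r₁ + m - s))
      (ceilExponent p (E - r₁ + m - s)), (h.mem_boundedLattices_iff_le hs hE _).2
      ⟨m, ?_, heq, standardLattice_le (by linarith) le_rfl⟩⟩
    have := hasIndex_span_single_smul e (m - ceilExponent p (E - r₁ + m - s))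
      (ceilExponent p (E - r₁ + m - s))
    rwa [sub_add_cancel] at this

theorem IsNormalForm.existsUnique_boundedLattices_iff (h : IsNormalForm e Φ a s)
    (hs : ¬ ((p : ℤ) + 1 ∣ s)) {E r₁ r₂ : ℕ} (hE : r₁ ≤ E) :
    (∃! 𝔐, 𝔐 ∈ boundedLattices Φ E r₁ r₂) ↔ ∃ m : ℤ,
      ((p : ℤ) - 1) * m = 2 * E - (r₁ + r₂) - s ∧
      ceilExponent p (E - r₁ + m) + ceilExponent p (E - r₁ + m - s) = m := by
  constructor
  · rintro ⟨𝔐, h𝔐, huniq⟩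
    obtain ⟨m, heq, hle⟩ := (h.boundedLattices_nonempty_iff hs hE).1 ⟨𝔐, h𝔐⟩
    refine ⟨m, heq, le_antisymm hle ?_⟩
    set α := ceilExponent p (E - r₁ + m)
    set β := ceilExponent p (E - r₁ + m - s)
    -- Putting the slack `m - α - β` on either basis vector gives two admissible lattices, which
    -- coincide only if it vanishes.
    have h1 : standardLattice e (m - β) β ∈ boundedLattices Φ E r₁ r₂ := by
      refine (h.mem_boundedLattices_iff_le hs hE _).2
        ⟨m, ?_, heq, standardLattice_le (by linarith) le_rfl⟩
      have := hasIndex_span_single_smul e (m - β) β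
      rwa [sub_add_cancel] at this
    have h2 : standardLattice e α (m - α) ∈ boundedLattices Φ E r₁ r₂ := by
      refine (h.mem_boundedLattices_iff_le hs hE _).2
        ⟨m, ?_, heq, standardLattice_le le_rfl (by linarith)⟩
      have := hasIndex_span_single_smul e α (m - α)
      rwa [add_sub_cancel] at this
    have h3 := le_of_standardLattice_le ((huniq _ h2).trans (huniq _ h1).symm).le
    linarith
  · rintro ⟨m, heq, hm⟩
    have hidx := hasIndex_span_single_smul e (ceilExponent p (E - r₁ + m))
      (ceilExponent p (E - r₁ + m - s))
    rw [hm] at hidx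
    refine ⟨standardLattice e (ceilExponent p (E - r₁ + m)) (ceilExponent p (E - r₁ + m - s)),
      (h.mem_boundedLattices_iff_le hs hE _).2 ⟨m, hidx, heq, le_rfl⟩, fun 𝔐 h𝔐 => ?_⟩
    obtain ⟨m', hm', heq', hle⟩ := (h.mem_boundedLattices_iff_le hs hE 𝔐).1 h𝔐
    have hp1 : (1 : ℤ) < p := by exact_mod_cast hp.out.one_lt
    obtain rfl : m' = m := mul_left_cancel₀ (by omega : (p : ℤ) - 1 ≠ 0) (heq'.trans heq.symm)
    exact hm'.eq_of_le hidx hle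

end Count

/-! ### The numerical condition -/

section Numerical

/-- The arguments differ by `t < 1`, so the ceilings differ by at most one, and their sum vanishes
only if both do. -/
theorem ceil_add_ceil_eq_zero_iff {t ρ : ℚ} (h0 : 0 ≤ t) (h1 : t < 1) :
    ⌈(t - ρ) / 2⌉ + ⌈(-t - ρ) / 2⌉ = 0 ↔ t ≤ ρ ∧ ρ < 2 - t := by
  have hle : ⌈(-t - ρ) / 2⌉ ≤ ⌈(t - ρ) / 2⌉ := Int.ceil_mono (by linarith)
  have hle' : ⌈(t - ρ) / 2⌉ ≤ ⌈(-t - ρ) / 2⌉ + 1 := by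
    rw [← Int.ceil_add_one]
    exact Int.ceil_mono (by linarith)
  constructor
  · intro h
    have ha : ⌈(t - ρ) / 2⌉ = 0 := by omega
    have hb : ⌈(-t - ρ) / 2⌉ = 0 := by omega
    rw [Int.ceil_eq_iff] at ha hb
    push_cast at ha hb
    constructor <;> linarith
  · rintro ⟨h2, h3⟩
    have ha : ⌈(t - ρ) / 2⌉ = 0 := by
      rw [Int.ceil_eq_iff]
      push_cast
      constructor <;> linarith
    have hb : ⌈(-t - ρ) / 2⌉ = 0 := by
      rw [Int.ceil_eq_iff]
      push_cast
      constructor <;> linarith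
    rw [ha, hb, add_zero]

/-- With `s = (p + 1)(n + ξ)` and `ρ = (r₁ - r₂) / (p + 1)`, the index equation turns the two
arguments into `(m ± (n + ξ) - ρ) / 2`. Removing integers leaves `(±ξ - ρ) / 2` when `m - n` is even
and `(±(1 - ξ) - ρ) / 2` when it is odd. -/
theorem ceilExponent_add_ceilExponent_eq_iff {p : ℕ} {s E r₁ r₂ m : ℤ} (hs : ¬ ((p : ℤ) + 1 ∣ s))
    (hm : ((p : ℤ) - 1) * m = 2 * E - (r₁ + r₂) - s) :
    ceilExponent p (E - r₁ + m) + ceilExponent p (E - r₁ + m - s) = m ↔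
    (⌊(s : ℚ) / (p + 1)⌋ ≡ m [ZMOD 2] →
      Int.fract ((s : ℚ) / (p + 1)) ≤ ((r₁ : ℚ) - r₂) / (p + 1) ∧
      ((r₁ : ℚ) - r₂) / (p + 1) < 2 - Int.fract ((s : ℚ) / (p + 1))) ∧
    (¬ ⌊(s : ℚ) / (p + 1)⌋ ≡ m [ZMOD 2] →
      1 - Int.fract ((s : ℚ) / (p + 1)) ≤ ((r₁ : ℚ) - r₂) / (p + 1) ∧
      ((r₁ : ℚ) - r₂) / (p + 1) < 1 + Int.fract ((s : ℚ) / (p + 1))) := by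
  have hpos : (p : ℚ) + 1 ≠ 0 := by positivity
  have hx := Int.floor_add_fract ((s : ℚ) / (p + 1))
  have hξ0 := Int.fract_nonneg ((s : ℚ) / (p + 1))
  have hξ1 := Int.fract_lt_one ((s : ℚ) / (p + 1))
  set n := ⌊(s : ℚ) / (p + 1)⌋
  set ξ := Int.fract ((s : ℚ) / (p + 1))
  set ρ := ((r₁ : ℚ) - r₂) / (p + 1) with hρ
  -- Strict positivity is needed in the odd case, where `1 - ξ < 1` is required.
  have hξ : 0 < ξ := by
    refine lt_of_le_of_ne hξ0 fun h => hs ⟨n, ?_⟩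
    rw [← h, add_zero, eq_div_iff hpos] at hx
    have : (n * (p + 1) : ℤ) = s := by exact_mod_cast hx
    rw [← this, mul_comm]
  have hmQ : ((p : ℚ) - 1) * m = 2 * E - (r₁ + r₂) - s := by exact_mod_cast hm
  have hA : ((E - r₁ + m : ℤ) : ℚ) / (p + 1) = (m + (n + ξ) - ρ) / 2 := by
    rw [hx, hρ]
    field_simp
    push_cast
    linear_combination -hmQ
  have hB : ((E - r₁ + m - s : ℤ) : ℚ) / (p + 1) = (m - (n + ξ) - ρ) / 2 := by
    rw [hx, hρ]
    field_simp
    push_cast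
    linear_combination -hmQ
  rw [ceilExponent, ceilExponent, hA, hB]
  by_cases hmn : n ≡ m [ZMOD 2]
  · obtain ⟨k, hk⟩ := hmn.dvd
    obtain rfl : m = n + 2 * k := by omega
    have h1 : ((n + 2 * k : ℤ) + (n + ξ) - ρ) / 2 = (ξ - ρ) / 2 + (n + k : ℤ) := by
      push_cast; ring
    have h2 : ((n + 2 * k : ℤ) - (n + ξ) - ρ) / 2 = (-ξ - ρ) / 2 + (k : ℤ) := by
      push_cast; ring
    rw [h1, h2, Int.ceil_add_intCast, Int.ceil_add_intCast]
    simp only [hmn, not_true_eq_false, false_imp_iff, and_true, true_imp_iff]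
    rw [← ceil_add_ceil_eq_zero_iff hξ0 hξ1]
    omega
  · obtain ⟨k, rfl⟩ : ∃ k, m = n + 2 * k + 1 := ⟨(m - n) / 2, by
      rw [Int.ModEq] at hmn
      omega⟩
    have h1 : ((n + 2 * k + 1 : ℤ) + (n + ξ) - ρ) / 2 =
        (-(1 - ξ) - ρ) / 2 + (n + k + 1 : ℤ) := by
      push_cast; ring
    have h2 : ((n + 2 * k + 1 : ℤ) - (n + ξ) - ρ) / 2 = ((1 - ξ) - ρ) / 2 + (k : ℤ) := by
      push_cast; ring
    rw [h1, h2, Int.ceil_add_intCast, Int.ceil_add_intCast]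
    simp only [hmn, not_false_eq_true, false_imp_iff, true_and, true_imp_iff]
    rw [show 1 + ξ = 2 - (1 - ξ) by ring,
      ← ceil_add_ceil_eq_zero_iff (by linarith : 0 ≤ 1 - ξ) (by linarith)]
    omega

variable {Ψ : Type*} [Fintype Ψ] (v : Ψ → ℕ)

theorem dualPart_eq_sum (i : ℕ) : dualPart v i = ∑ ψ, if i ≤ v ψ then 1 else 0 := by
  rw [dualPart, Set.ncard_eq_toFinset_card', Finset.card_eq_sum_ones, Finset.sum_ite]
  simp

theorem dualPart_le_card (i : ℕ) : dualPart v i ≤ Fintype.card Ψ := by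
  rw [dualPart, ← Nat.card_eq_fintype_card]
  exact Set.ncard_le_card _

theorem sum_eq_dualPart_add (hv : ∀ ψ, v ψ ≤ 2) : ∑ ψ, v ψ = dualPart v 1 + dualPart v 2 := by
  rw [dualPart_eq_sum, dualPart_eq_sum, ← Finset.sum_add_distrib]
  refine Finset.sum_congr rfl fun ψ _ => ?_
  have := hv ψ
  split_ifs <;> omega

theorem singlePointCondition_iff (hv : ∀ ψ, v ψ ≤ 2) {p : ℕ} {s : ℤ}
    (hs : ¬ ((p : ℤ) + 1 ∣ s)) :
    SinglePointCondition v p s ↔ ∃ m : ℤ, ((p : ℤ) - 1) * m =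
      2 * (Fintype.card Ψ : ℤ) - ((dualPart v 1 : ℤ) + dualPart v 2) - s ∧
      ceilExponent p (Fintype.card Ψ - dualPart v 1 + m) +
        ceilExponent p (Fintype.card Ψ - dualPart v 1 + m - s) = m := by
  have hsum : ∑ ψ, (v ψ : ℤ) = (dualPart v 1 : ℤ) + dualPart v 2 := by
    exact_mod_cast sum_eq_dualPart_add v hv
  rw [SinglePointCondition, hsum]
  refine exists_congr fun m => and_congr_right fun hm => ?_
  rw [ceilExponent_add_ceilExponent_eq_iff hs hm]
  rfl

end Numerical

/-! ### Closed Kisin varieties -/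

section Main

variable {p : ℕ} [hp : Fact p.Prime] {F : Type u} [Field F] {M : Type w} [AddCommGroup M]
  [Module F⸨X⸩ M] {Φ : M →ₛₗ[phi p F] M} {s : ℤ} {Ψ : Type*} [Fintype Ψ] {v : Ψ → ℕ}

theorem IsNormalForm.existsUnique_GRloc_iff {b : Module.Basis (Fin 2) F⸨X⸩ M} {a : F}
    (h : IsNormalForm b Φ a s) (hs : ¬ ((p : ℤ) + 1 ∣ s)) (hv : ∀ ψ, v ψ ≤ 2)
    (L : Type*) [Field L] [Algebra F L] :
    (∃! 𝔐, 𝔐 ∈ GRloc Φ v L) ↔ SinglePointCondition v p s := by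
  obtain ⟨e, he⟩ := h.exists_baseChange L
  exact (he.existsUnique_boundedLattices_iff hs (dualPart_le_card v 1)).trans
    (singlePointCondition_iff v hv hs).symm

theorem IsNormalForm.GRloc_nonempty_iff {b : Module.Basis (Fin 2) F⸨X⸩ M} {a : F}
    (h : IsNormalForm b Φ a s) (hs : ¬ ((p : ℤ) + 1 ∣ s)) (L L' : Type*) [Field L] [Algebra F L]
    [Field L'] [Algebra F L'] : (GRloc Φ v L).Nonempty ↔ (GRloc Φ v L').Nonempty := by
  obtain ⟨e, he⟩ := h.exists_baseChange L
  obtain ⟨e', he'⟩ := h.exists_baseChange L'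
  exact (he.boundedLattices_nonempty_iff hs (dualPart_le_card v 1)).trans
    (he'.boundedLattices_nonempty_iff hs (dualPart_le_card v 1)).symm

theorem ClosedKisinVariety.nonempty_unique_points_iff {Z : Scheme.{u}}
    {π : Z ⟶ Spec (CommRingCat.of F)} (hZ : ClosedKisinVariety Φ v π) (K : Type u) [Field K]
    [Algebra F K] [FiniteDimensional F K] :
    Nonempty (Unique (Points π K)) ↔ ∃! 𝔐, 𝔐 ∈ GRloc Φ v K := by
  rw [(hZ.pointsEquiv K).uniqueCongr.nonempty_congr, ← unique_subtype_iff_existsUnique]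

/-- The residue field of the unique point could a priori be larger than `F`. Since existence of a
lattice does not depend on the field, there is also an `F`-point, which excludes this. -/
theorem IsNormalForm.isIso_of_nonempty_unique {b : Module.Basis (Fin 2) F⸨X⸩ M} {a : F}
    (h : IsNormalForm b Φ a s) (hs : ¬ ((p : ℤ) + 1 ∣ s)) {Z : Scheme.{u}}
    {π : Z ⟶ Spec (CommRingCat.of F)} (hZ : ClosedKisinVariety Φ v π)
    (hU : Nonempty (Unique Z)) : IsIso π := by
  have := hZ.isReduced
  have := hZ.locallyOfFiniteType
  obtain ⟨hU⟩ := hU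
  obtain ⟨K, _, _, _, g, -⟩ := exists_isIso_point (π := π)
  obtain ⟨𝔐, h𝔐⟩ := (h.GRloc_nonempty_iff (v := v) hs K F).1 ⟨_, (hZ.pointsEquiv K g).2⟩
  exact isIso_of_subsingleton ((hZ.pointsEquiv F).symm ⟨𝔐, h𝔐⟩)

theorem IsNormalForm.isIso_iff {b : Module.Basis (Fin 2) F⸨X⸩ M} {a : F}
    (h : IsNormalForm b Φ a s) (hs : ¬ ((p : ℤ) + 1 ∣ s)) (hv : ∀ ψ, v ψ ≤ 2) {Z : Scheme.{u}}
    {π : Z ⟶ Spec (CommRingCat.of F)} (hZ : ClosedKisinVariety Φ v π) :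
    IsIso π ↔ SinglePointCondition v p s := by
  have := hZ.isReduced
  have := hZ.locallyOfFiniteType
  constructor
  · intro _
    rw [← h.existsUnique_GRloc_iff hs hv F, ← hZ.nonempty_unique_points_iff F]
    exact nonempty_unique_points_of_isIso F
  · intro hc
    have hU (K : Type u) [Field K] [Algebra F K] [FiniteDimensional F K] :
        Nonempty (Unique (Points π K)) :=
      (hZ.nonempty_unique_points_iff K).2 ((h.existsUnique_GRloc_iff hs hv K).2 hc)
    have : Subsingleton Z := subsingleton_of_subsingleton_points (π := π) fun K _ _ _ =>
      (hU K).some.instSubsingleton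
    exact isIso_of_subsingleton (hU F).some.default

theorem IsNormalForm.nonempty_unique_iff {b : Module.Basis (Fin 2) F⸨X⸩ M} {a : F}
    (h : IsNormalForm b Φ a s) (hs : ¬ ((p : ℤ) + 1 ∣ s)) (hv : ∀ ψ, v ψ ≤ 2) {Z : Scheme.{u}}
    {π : Z ⟶ Spec (CommRingCat.of F)} (hZ : ClosedKisinVariety Φ v π) :
    Nonempty (Unique Z) ↔ SinglePointCondition v p s := by
  rw [← h.isIso_iff hs hv hZ]
  refine ⟨h.isIso_of_nonempty_unique hs hZ, fun _ => ?_⟩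
  exact ⟨(Scheme.homeoOfIso (asIso π)).toEquiv.unique⟩

end Main

end KisinVariety

end

theorem mainTheorem6 {p : ℕ} [Fact p.Prime] {F : Type u} [Field F] [Finite F] [CharP F p]
    {M : Type w} [AddCommGroup M] [Module F⸨X⸩ M] (Φ : M →ₛₗ[KisinVariety.phi p F] M)
    (hM : KisinVariety.IsRankTwoPhiModule Φ) (hsimple : KisinVariety.IsAbsolutelySimple Φ)
    (s : ℤ) (hs : KisinVariety.HasNormalForm Φ s)
    {Ψ : Type*} [Fintype Ψ] (v : Ψ → ℕ) (hv : ∀ ψ, v ψ ≤ 2) :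
    ((∀ (F' : Type u) [Field F'] [Algebra F F'] [FiniteDimensional F F'],
        ∃! 𝔐, 𝔐 ∈ KisinVariety.GRloc Φ v F') ↔ KisinVariety.SinglePointCondition v p s) ∧
    ∀ (Z : Scheme.{u}) (π : Z ⟶ Spec (CommRingCat.of F)),
      KisinVariety.ClosedKisinVariety Φ v π →
        (IsIso π ↔ KisinVariety.SinglePointCondition v p s) ∧
        (Nonempty (Unique Z) ↔ KisinVariety.SinglePointCondition v p s) := by
  obtain ⟨b, a, h⟩ := hs.exists_isNormalForm hM.finrank_eq
  have hps := hs.2.2.1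
  exact ⟨⟨fun H => (h.existsUnique_GRloc_iff hps hv F).1 (H F),
      fun H F' _ _ _ => (h.existsUnique_GRloc_iff hps hv F').2 H⟩,
    fun Z π hZ => ⟨h.isIso_iff hps hv hZ, h.nonempty_unique_iff hps hv hZ⟩⟩
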